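/- Notation. For $s\ge 0$, $x\in\mathbb R$ and $n\ge 0$ put $F_{s,n}(x)=\sum_{k=1}^{n}\frac{e^{i\pi k^2x}}{k^s}$; we say that $F_s(x)$ converges if $\lim_{n\to\infty}F_{s,n}(x)$ exists, and then $F_s(x)$ denotes this limit. Let $\rho=e^{i\pi/4}$, let $\sigma(x)=1,-1,0$ according as $x>0$, $x<0$, $x=0$, and use principal powers. For $x>0$ let $$I_s(x)=\int_{1/2-\rho\infty}^{1/2+\rho\infty}\frac{e^{i\pi z^2x}}{z^s(1-e^{2i\pi z})}\,dz+\rho x^s\int_{-\infty}^{\infty}e^{-\pi xu^2}\left(\sum_{k=1}^{\infty}e^{-i\pi k^2/x}\Big(\frac1{(\rho xu+k)^s}-\frac1{k^s}\Big)\right)du,$$ and put $\Omega_s(x)=I_s(x)$ if $x>0$, $\Omega_s(x)=\overline{I_s(-x)}$ if $x<0$. Let $T(x)=-\frac1x \bmod 2$, with values in $[-1,1)$, and let $T^j$ be its $j$-th iterate; the empty product $xT(x)\cdots T^{j-1}(x)$ for $j=0$ is $1$. Theorem. Let $x\in(-1,1)$ be irrational. (i) Let $s\in(\frac12,1)$.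 If $$\sum_{j=0}^{\infty}\frac{|xT(x)\cdots T^{j-1}(x)|^{s-\frac12}}{|T^j(x)|^{\frac{1-s}2}}<\infty,$$ then $F_s(x)$ converges and $$F_s(x)=\sum_{j=0}^{\infty}e^{i\frac{\pi}4\sum_{\ell=0}^{j-1}\sigma(T^\ell x)}\,|xT(x)\cdots T^{j-1}(x)|^{s-\frac12}\,\Omega_s(T^j(x)).$$ (ii) If $$\sum_{j=0}^{\infty}\sqrt{|xT(x)\cdots T^{j-1}(x)|}<\infty\quad\text{and}\quad\sum_{j=0}^{\infty}\sqrt{|xT(x)\cdots T^{j-1}(x)|}\,\log\Big(\frac1{|T^j(x)|}\Big)<\infty,$$ then $F_1(x)$ converges and $$F_1(x)=\sum_{j=0}^{\infty}e^{i\frac{\pi}4\sum_{\ell=0}^{j-1}\sigma(T^\ell x)}\sqrt{|xT(x)\cdots T^{j-1}(x)|}\;\Omega_1(T^j(x)).$$ -/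

import Mathlib

open Filter Topology

namespace HardyLittlewood

noncomputable section

/-- The partial sum `F_{s,n}(x,t) = ∑_{k=1}^{n} e^{iπk²x + 2iπkt} / k^s`. -/
def partialF (s : ℝ) (n : ℕ) (x t : ℝ) : ℂ :=
  ∑ k ∈ Finset.Icc 1 n,
    Complex.exp (Complex.I * Real.pi * (k : ℂ) ^ 2 * x + 2 * Complex.I * Real.pi * k * t)
      / (k : ℂ) ^ (s : ℂ)

/-- `ρ = e^{iπ/4}`. -/
def rho : ℂ := Complex.exp (Complex.I * Real.pi / 4)

/-- The integrand `e^{iπz²x + 2iπz{t}} / (z^s (1 - e^{2iπz}))` of the contour integral in `I_s`;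
the power is the principal one. -/
def contourIntegrand (s x t : ℝ) (z : ℂ) : ℂ :=
  Complex.exp (Complex.I * Real.pi * z ^ 2 * x + 2 * Complex.I * Real.pi * z * (Int.fract t : ℝ))
    / (z ^ (s : ℂ) * (1 - Complex.exp (2 * Complex.I * Real.pi * z)))

/-- The series
`∑_{k ≥ 1} e^{-iπ(k-{t})²/x} (1/(ρxu + k - {t})^s - 1/k^s)`, summed over `k + 1`, `k : ℕ`. -/
def innerSeries (s x t u : ℝ) : ℂ :=
  ∑' k : ℕ,
    Complex.exp (-Complex.I * Real.pi * ((k : ℂ) + 1 - (Int.fract t : ℝ)) ^ 2 / x)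
      * (1 / (rho * x * u + ((k : ℂ) + 1) - (Int.fract t : ℝ)) ^ (s : ℂ)
          - 1 / ((k : ℂ) + 1) ^ (s : ℂ))

/-- The function `I_s(x,t)` (`x > 0`, `s ≥ 0`). The first integral is the integral along the line
from `1/2 - ρ∞` to `1/2 + ρ∞`, parametrized by `z = 1/2 + ρu`, `dz = ρ du`. -/
def fnI (s x t : ℝ) : ℂ :=
  (∫ u : ℝ, contourIntegrand s x t (1 / 2 + rho * u) * rho)
    + rho * ((x ^ s : ℝ) : ℂ)
        * ∫ u : ℝ, Complex.exp (-Real.pi * x * (u : ℂ) ^ 2) * innerSeries s x t u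

/-- `Ω_s(x,t)` is `I_s(x,t)` for `x > 0` and the conjugate of `I_s(-x,-t)` for `x < 0`
(the value `0` at `x = 0` is a convention that is never used). -/
def Omega (s x t : ℝ) : ℂ :=
  if 0 < x then fnI s x t
  else if x < 0 then (starRingEnd ℂ) (fnI s (-x) (-t))
  else 0

/-- `T(x) = -1/x mod 2`, with representative in `[-1,1)`. -/
def T (x : ℝ) : ℝ := toIcoMod (two_pos : (0 : ℝ) < 2) (-1) (-1 / x)

/-- `|x T(x) ⋯ T^{j-1}(x)|`, equal to `1` for `j = 0`. -/
def absProd (x : ℝ) (j : ℕ) : ℝ := |∏ l ∈ Finset.range j, T^[l] x|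

/-- `e^{(iπ/4) ∑_{l=0}^{j-1} σ(T^l x)}`, where `σ` is the sign function. -/
def phase (x : ℝ) (j : ℕ) : ℂ :=
  Complex.exp (Complex.I * (Real.pi / 4)
    * ((∑ l ∈ Finset.range j, Real.sign (T^[l] x) : ℝ) : ℂ))

end

end HardyLittlewood

namespace HardyLittlewood

open MeasureTheory

lemma rho_eq : rho = ((√2 / 2 : ℝ) : ℂ) * (1 + Complex.I) := by
  have h : rho = Complex.exp (((Real.pi / 4 : ℝ) : ℂ) * Complex.I) := by
    unfold rho; congr 1; push_cast; ring
  rw [h, Complex.exp_mul_I, ← Complex.ofReal_cos, ← Complex.ofReal_sin,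
    Real.cos_pi_div_four, Real.sin_pi_div_four]
  ring

lemma rho_re : rho.re = √2 / 2 := by rw [rho_eq]; simp

lemma rho_im : rho.im = √2 / 2 := by rw [rho_eq]; simp

lemma rho_sq : rho ^ 2 = Complex.I := by
  have h : rho ^ 2 = Complex.exp (Real.pi / 2 * Complex.I) := by
    unfold rho; rw [← Complex.exp_nat_mul]; congr 1; push_cast; ring
  rw [h, Complex.exp_pi_div_two_mul_I]

lemma norm_rho : ‖rho‖ = 1 := by
  have h : rho = Complex.exp (((Real.pi / 4 : ℝ) : ℂ) * Complex.I) := by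
    unfold rho; congr 1; push_cast; ring
  rw [h, Complex.norm_exp_ofReal_mul_I]

lemma rho_ne_zero : rho ≠ 0 := Complex.exp_ne_zero _

/-! ### Geometry of the lines c + ρu -/

lemma normSq_line (c u : ℝ) : ‖(c : ℂ) + rho * u‖ ^ 2 = c ^ 2 + √2 * c * u + u ^ 2 := by
  rw [Complex.sq_norm, Complex.normSq_apply]
  simp only [Complex.add_re, Complex.add_im, Complex.mul_re, Complex.mul_im, Complex.ofReal_re,
    Complex.ofReal_im, rho_re, rho_im]
  have : √2 * √2 = 2 := Real.mul_self_sqrt (by norm_num)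
  linear_combination (u ^ 2 / 2) * this

/-- The line meets the real axis at 45°, so its distance from 0 is |c|/√2; algebraically, complete
the square in u. The companion bound follows from the symmetry of the quadratic form in c and u. -/
lemma le_norm_line_left (c u : ℝ) : |c| / √2 ≤ ‖(c : ℂ) + rho * u‖ := by
  have h2 : √2 ^ 2 = 2 := Real.sq_sqrt (by norm_num)
  apply le_of_sq_le_sq _ (norm_nonneg _)
  rw [normSq_line, div_pow, sq_abs, h2]
  nlinarith [sq_nonneg (√2 * c / 2 + u)]

lemma le_norm_line_right (c u : ℝ) : |u| / √2 ≤ ‖(c : ℂ) + rho * u‖ := by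
  have h2 : √2 ^ 2 = 2 := Real.sq_sqrt (by norm_num)
  apply le_of_sq_le_sq _ (norm_nonneg _)
  rw [normSq_line, div_pow, sq_abs, h2]
  nlinarith [sq_nonneg (√2 * u / 2 + c)]

/-- The line meets the real axis only at c > 0, hence avoids the cut of the principal power. -/
lemma line_mem_slitPlane {c : ℝ} (hc : 0 < c) (u : ℝ) :
    (c : ℂ) + rho * u ∈ Complex.slitPlane := by
  rw [Complex.mem_slitPlane_iff]
  by_cases hu : u = 0
  · left; simp [hu, hc]
  · right
    simp [rho_re, rho_im, hu]

/-! ### Gaussian decay and contour shifts -/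

/-- Half of the Gaussian absorbs the linear exponent: the difference of the exponents is (A -
δ|u|)²/(2δ). -/
lemma exp_linear_sub_sq_le (A : ℝ) {δ : ℝ} (hδ : 0 < δ) (u : ℝ) :
    Real.exp (A * |u| - δ * u ^ 2)
      ≤ Real.exp (A ^ 2 / (2 * δ)) * Real.exp (-(δ / 2) * u ^ 2) := by
  rw [← Real.exp_add, Real.exp_le_exp, ← sub_nonneg]
  have : A ^ 2 / (2 * δ) + -(δ / 2) * u ^ 2 - (A * |u| - δ * u ^ 2)
      = (A - δ * |u|) ^ 2 / (2 * δ) := by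
    rw [← sq_abs u]; field_simp; ring
  rw [this]; positivity

/-- A continuous function on a line with Gaussian decay is integrable. -/
lemma integrable_of_gaussian_bound {f : ℝ → ℂ} (hf : Continuous f) {C δ : ℝ} (hδ : 0 < δ)
    (hb : ∀ u, 1 ≤ |u| → ‖f u‖ ≤ C * Real.exp (-δ * u ^ 2)) : Integrable f := by
  have hg : Integrable (fun u : ℝ => C * Real.exp (-δ * u ^ 2)) :=
    (integrable_exp_neg_mul_sq hδ).const_mul C
  refine hf.locallyIntegrable.integrable_of_isBigO_atBot_atTop
    (g := fun u : ℝ => C * Real.exp (-δ * u ^ 2)) (g' := fun u : ℝ => C * Real.exp (-δ * u ^ 2))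
    ?_ (hg.integrableAtFilter _) ?_ (hg.integrableAtFilter _)
  · refine Asymptotics.IsBigO.of_bound 1 ?_
    filter_upwards [eventually_le_atBot (-1)] with u hu
    rw [one_mul]
    exact (hb u (by rw [abs_of_neg (by linarith)]; linarith)).trans (Real.le_norm_self _)
  · refine Asymptotics.IsBigO.of_bound 1 ?_
    filter_upwards [eventually_ge_atTop 1] with u hu
    rw [one_mul]
    exact (hb u (by rw [abs_of_pos (by linarith)]; linarith)).trans (Real.le_norm_self _)

lemma tendsto_gaussian_atTop {δ : ℝ} (hδ : 0 < δ) (C : ℝ) :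
    Tendsto (fun R : ℝ => C * Real.exp (-δ * R ^ 2)) atTop (𝓝 0) := by
  have h : Tendsto (fun R : ℝ => -δ * R ^ 2) atTop atBot :=
    (tendsto_pow_atTop (two_ne_zero)).const_mul_atTop_of_neg (by linarith)
  simpa using (Real.tendsto_exp_atBot.comp h).const_mul C

/-- Cauchy's theorem on a strip bounded by two parallel lines of direction `rho`. -/
lemma line_shift {G : ℂ → ℂ} {a b : ℝ} (hab : a ≤ b)
    (hG : ∀ c ∈ Set.Icc a b, ∀ u : ℝ, AnalyticAt ℂ G ((c : ℂ) + rho * u))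
    {C δ : ℝ} (hδ : 0 < δ)
    (hb : ∀ c ∈ Set.Icc a b, ∀ u : ℝ, 1 ≤ |u| →
      ‖G ((c : ℂ) + rho * u)‖ ≤ C * Real.exp (-δ * u ^ 2)) :
    ∫ u : ℝ, G ((a : ℂ) + rho * u) = ∫ u : ℝ, G ((b : ℂ) + rho * u) := by
  let L : ℝ × ℝ → ℂ := fun p => (p.1 : ℂ) + rho * p.2
  have hLc : Continuous L := by fun_prop
  let L' : ℝ × ℝ →L[ℝ] ℂ :=
    Complex.ofRealCLM.comp (ContinuousLinearMap.fst ℝ ℝ ℝ)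
      + rho • Complex.ofRealCLM.comp (ContinuousLinearMap.snd ℝ ℝ ℝ)
  have hL : ∀ p, HasFDerivAt L L' p := by
    intro p
    have : L = fun p => L' p := by
      ext p; simp [L, L']
    rw [this]
    exact L'.hasFDerivAt
  have hint : ∀ c ∈ Set.Icc a b, Integrable (fun u : ℝ => G ((c : ℂ) + rho * u)) := by
    intro c hc
    refine integrable_of_gaussian_bound ?_ hδ (hb c hc)
    rw [continuous_iff_continuousAt]
    intro u
    exact ContinuousAt.comp (f := fun u : ℝ => (c : ℂ) + rho * u) (hG c hc u).continuousAt
      (by fun_prop)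
  have hGL : ∀ c ∈ Set.Icc a b, ∀ u : ℝ,
      HasFDerivAt (fun p => G (L p)) (deriv G (L (c, u)) • L') (c, u) := by
    intro c hc u
    have h1 := (hG c hc u).differentiableAt.hasDerivAt
    have h2 := h1.comp_hasFDerivAt (𝕜 := ℝ) (f := L) (c, u) (hL (c, u))
    exact h2
  have key : ∀ R : ℝ, (∫ u in (-R)..R, G ((b : ℂ) + rho * u)) - (∫ u in (-R)..R, G ((a : ℂ) + rho * u))
      = rho⁻¹ * ((∫ c in a..b, G ((c : ℂ) + rho * (R : ℝ)))
          - ∫ c in a..b, G ((c : ℂ) + rho * ((-R : ℝ) : ℂ))) := by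
    intro R
    have hmem : ∀ p ∈ Set.uIcc a b ×ˢ Set.uIcc (-R) R, p.1 ∈ Set.Icc a b := by
      intro p hp
      have := hp.1
      rwa [Set.uIcc_of_le hab] at this
    have hcont : ContinuousOn (fun p => G (L p)) (Set.uIcc a b ×ˢ Set.uIcc (-R) R) := fun p hp =>
      (hGL p.1 (hmem p hp) p.2).continuousAt.continuousWithinAt
    have hmem' : ∀ p ∈ Set.Ioo (min a b) (max a b) ×ˢ Set.Ioo (min (-R) R) (max (-R) R) \ ∅,
        p.1 ∈ Set.Icc a b := by
      intro p hp
      have := hp.1.1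
      rw [min_eq_left hab, max_eq_right hab] at this
      exact ⟨this.1.le, this.2.le⟩
    -- Cauchy's theorem as the divergence theorem in the coordinates (c, u): by the chain rule the
    -- field (ρG, -G) has divergence ρG' - ρG' = 0.
    have D := integral2_divergence_prod_of_hasFDerivAt_off_countable
      (fun p => rho * G (L p)) (fun p => -G (L p))
      (fun p => rho • (deriv G (L p) • L')) (fun p => -(deriv G (L p) • L')) a (-R) b R ∅
      Set.countable_empty (continuousOn_const.mul hcont) hcont.neg
      (fun p hp => (hGL p.1 (hmem' p hp) p.2).const_mul rho)
      (fun p hp => (hGL p.1 (hmem' p hp) p.2).neg)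
      (by
        refine integrableOn_zero.congr_fun (fun p _ => ?_)
          (measurableSet_uIcc.prod measurableSet_uIcc)
        simp [L']; ring)
    have hz : ∀ p : ℝ × ℝ, (rho • (deriv G (L p) • L')) (1, 0) + (-(deriv G (L p) • L')) (0, 1) = 0 := by
      intro p; simp [L']; ring
    simp only [hz, intervalIntegral.integral_zero] at D
    simp only [intervalIntegral.integral_neg, intervalIntegral.integral_const_mul, L] at D
    rw [eq_inv_mul_iff_mul_eq₀ rho_ne_zero]
    linear_combination (-1 : ℂ) * D
  have lim1 : ∀ c ∈ Set.Icc a b, Tendsto (fun R : ℝ => ∫ u in (-R)..R, G ((c : ℂ) + rho * u)) atTop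
      (𝓝 (∫ u : ℝ, G ((c : ℂ) + rho * u))) := fun c hc =>
    intervalIntegral_tendsto_integral (hint c hc) tendsto_neg_atTop_atBot tendsto_id
  -- Treats both short sides at once: `s` is R ↦ R or R ↦ -R.
  have side : ∀ s : ℝ → ℝ, (∀ R, |s R| = |R|) →
      Tendsto (fun R : ℝ => ∫ c in a..b, G ((c : ℂ) + rho * (s R : ℝ))) atTop (𝓝 0) := by
    intro s hs
    have h0 := tendsto_gaussian_atTop hδ (C * |b - a|)
    refine squeeze_zero_norm' ?_ h0
    filter_upwards [eventually_ge_atTop 1] with R hR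
    have := intervalIntegral.norm_integral_le_of_norm_le_const (a := a) (b := b)
      (f := fun c : ℝ => G ((c : ℂ) + rho * (s R : ℝ))) (C := C * Real.exp (-δ * R ^ 2)) (by
        intro c hc
        rw [Set.uIoc_of_le hab] at hc
        have h1 := hb c ⟨hc.1.le, hc.2⟩ (s R) (by rw [hs, abs_of_pos (by linarith)]; exact hR)
        rwa [← sq_abs (s R), hs, sq_abs] at h1)
    linarith
  have l1 := ((lim1 b ⟨hab, le_rfl⟩).sub (lim1 a ⟨le_rfl, hab⟩))
  have l2 := ((side (fun R => R) (fun _ => rfl)).sub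
    (side (fun R => -R) (fun R => abs_neg R))).const_mul rho⁻¹
  simp only [key] at l1
  rw [sub_zero, mul_zero] at l2
  have := tendsto_nhds_unique l1 l2
  exact (sub_eq_zero.mp this).symm

/-! ### The integrand and its denominator on the lines -/

/-- The summand `e^{iπz²x} / z^s`, continued to the slit plane. -/
noncomputable def chirp (s x : ℝ) (z : ℂ) : ℂ :=
  Complex.exp (Complex.I * Real.pi * z ^ 2 * x) / z ^ (s : ℂ)

/-- The denominator `1 - e^{2iπz}`, whose zeros are the integers. -/
noncomputable def den (z : ℂ) : ℂ := 1 - Complex.exp (2 * Complex.I * Real.pi * z)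

lemma contourIntegrand_zero (s x : ℝ) (z : ℂ) :
    contourIntegrand s x 0 z = chirp s x z / den z := by
  simp [contourIntegrand, chirp, den, div_div]

lemma line_re (c u : ℝ) : ((c : ℂ) + rho * u).re = c + √2 / 2 * u := by simp [rho_re]

lemma line_im (c u : ℝ) : ((c : ℂ) + rho * u).im = √2 / 2 * u := by simp [rho_im]

/-- Since ρ² = i, the direction ρ turns the oscillation e^{iπxz²} into the Gaussian e^{-πxu²}; the
offset c contributes only a linear exponent. -/
lemma norm_exp_quadratic_line (x c u : ℝ) :
    ‖Complex.exp (Complex.I * Real.pi * ((c : ℂ) + rho * u) ^ 2 * x)‖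
      = Real.exp (-(Real.pi * x) * u ^ 2 - √2 * Real.pi * x * c * u) := by
  rw [Complex.norm_exp]
  congr 1
  have : Complex.I * Real.pi * ((c : ℂ) + rho * u) ^ 2 * x
      = (Real.pi * x : ℝ) * (Complex.I * ((c : ℂ) + rho * u) ^ 2) := by push_cast; ring
  rw [this, Complex.re_ofReal_mul, pow_two, Complex.I_mul_re, Complex.mul_im, line_re, line_im]
  have h2 : √2 * √2 = 2 := Real.mul_self_sqrt (by norm_num)
  linear_combination (-(Real.pi * x * u ^ 2 / 2)) * h2

lemma norm_exp_linear_line (c u : ℝ) :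
    ‖Complex.exp (2 * Complex.I * Real.pi * ((c : ℂ) + rho * u))‖
      = Real.exp (-(√2 * Real.pi) * u) := by
  rw [Complex.norm_exp]
  congr 1
  have : 2 * Complex.I * Real.pi * ((c : ℂ) + rho * u)
      = (2 * Real.pi : ℝ) * (Complex.I * ((c : ℂ) + rho * u)) := by push_cast; ring
  rw [this, Complex.re_ofReal_mul, Complex.I_mul_re, line_im]
  ring

lemma one_le_sqrt_two : 1 ≤ √2 := Real.one_le_sqrt.mpr (by norm_num)

lemma sqrt_two_le_two : √2 ≤ 2 := Real.sqrt_le_iff.mpr (by norm_num)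

lemma exp_neg_half_le {t : ℝ} (ht : 1 ≤ t) : Real.exp (-t) ≤ 1 / 2 := by
  rw [Real.exp_neg, inv_le_comm₀ (Real.exp_pos _) (by norm_num)]
  have := Real.add_one_le_exp t
  linarith

/-- For |u| ≥ 1 the modulus of e^{2iπz} is far from 1 whatever c is, even on lines through a pole.
-/
lemma half_le_norm_den {c u : ℝ} (hu : 1 ≤ |u|) : 1 / 2 ≤ ‖den ((c : ℂ) + rho * u)‖ := by
  unfold den
  have hn := norm_exp_linear_line c u
  have h1 := one_le_sqrt_two
  have hpi := Real.pi_gt_three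
  have hsp : 3 ≤ √2 * Real.pi := by nlinarith
  rcases le_abs.mp hu with h | h
  · have h3 := norm_sub_norm_le (1 : ℂ) (Complex.exp (2 * Complex.I * Real.pi * ((c : ℂ) + rho * u)))
    rw [hn, norm_one] at h3
    have := exp_neg_half_le (t := √2 * Real.pi * u) (by nlinarith)
    rw [← neg_mul] at this
    linarith
  · have h3 := norm_sub_norm_le (Complex.exp (2 * Complex.I * Real.pi * ((c : ℂ) + rho * u))) 1
    rw [hn, norm_one, norm_sub_rev] at h3
    have := Real.add_one_le_exp (-(√2 * Real.pi) * u)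
    nlinarith

/-- On lines through half integers the denominator is bounded below by half the larger of its
two terms. -/
lemma le_norm_den_half (n : ℤ) (u : ℝ) :
    max 1 (Real.exp (-(√2 * Real.pi) * u)) / 2 ≤ ‖den (((n + 1 / 2 : ℝ) : ℂ) + rho * u)‖ := by
  set c : ℝ := n + 1 / 2 with hc
  have hn := norm_exp_linear_line c u
  unfold den
  have h1 := one_le_sqrt_two
  have h12 := sqrt_two_le_two
  have h2 : √2 * √2 = 2 := Real.mul_self_sqrt (by norm_num)
  have hpi := Real.pi_gt_three
  have hE := Real.exp_pos (-(√2 * Real.pi) * u)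
  rcases le_total (1 / 2) (√2 * |u|) with h | h
  · rcases le_total 0 u with hu | hu
    · have h3 := norm_sub_norm_le (1 : ℂ)
        (Complex.exp (2 * Complex.I * Real.pi * ((c : ℂ) + rho * u)))
      rw [hn, norm_one] at h3
      rw [abs_of_nonneg hu] at h
      have := exp_neg_half_le (t := √2 * Real.pi * u) (by nlinarith)
      rw [← neg_mul] at this
      rw [max_eq_left (by linarith)]
      linarith
    · have h3 := norm_sub_norm_le (Complex.exp (2 * Complex.I * Real.pi * ((c : ℂ) + rho * u))) 1
      rw [hn, norm_one, norm_sub_rev] at h3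
      rw [abs_of_nonpos hu] at h
      have := Real.add_one_le_exp (-(√2 * Real.pi) * u)
      have h4 : 1 ≤ -(√2 * Real.pi) * u := by nlinarith
      rw [max_eq_right (by linarith)]
      linarith
  -- Near the real axis, e^{2iπz} has argument π + √2πu because c is a half integer. Hence its real
  -- part is nonpositive and |1 - w|² ≥ 1 + |w|².
  · set w := Complex.exp (2 * Complex.I * Real.pi * ((c : ℂ) + rho * u)) with hw
    have hre : w.re ≤ 0 := by
      have : w = -Complex.exp (2 * Complex.I * Real.pi * (rho * u)) := by
        rw [hw, hc]
        have : 2 * Complex.I * Real.pi * (((n + 1 / 2 : ℝ) : ℂ) + rho * u)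
            = 2 * Complex.I * Real.pi * (rho * u) + Real.pi * Complex.I
              + n * (2 * Real.pi * Complex.I) := by push_cast; ring
        rw [this, Complex.exp_add, Complex.exp_int_mul_two_pi_mul_I, Complex.exp_add,
          Complex.exp_pi_mul_I]
        ring
      rw [this, Complex.neg_re, Complex.exp_re, neg_nonpos]
      have him : (2 * Complex.I * Real.pi * (rho * u)).im = Real.pi * (√2 * u) := by
        have : 2 * Complex.I * Real.pi * (rho * u) = (2 * Real.pi * u : ℝ) * (Complex.I * rho) := by
          push_cast; ring
        rw [this, Complex.im_ofReal_mul, Complex.I_mul_im, rho_re]; ring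
      rw [him]
      refine mul_nonneg (Real.exp_pos _).le (Real.cos_nonneg_of_mem_Icc ?_)
      have h5 : |√2 * u| ≤ 1 / 2 := by rwa [abs_mul, abs_of_nonneg (Real.sqrt_nonneg 2)]
      have := abs_le.mp h5
      constructor <;> nlinarith
    have hsq : 1 + ‖w‖ ^ 2 ≤ ‖1 - w‖ ^ 2 := by
      rw [Complex.sq_norm, Complex.sq_norm, Complex.normSq_apply, Complex.normSq_apply]
      simp only [Complex.sub_re, Complex.sub_im, Complex.one_re, Complex.one_im]
      nlinarith
    have : max 1 (Real.exp (-(√2 * Real.pi) * u)) ≤ ‖1 - w‖ := by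
      rw [← hn]
      apply max_le
      · exact le_of_sq_le_sq (by nlinarith [sq_nonneg ‖w‖]) (norm_nonneg _)
      · exact le_of_sq_le_sq (by nlinarith) (norm_nonneg _)
    have hm : 1 ≤ max 1 (Real.exp (-(√2 * Real.pi) * u)) := le_max_left _ _
    linarith

lemma den_half_ne_zero (n : ℤ) (u : ℝ) : den (((n + 1 / 2 : ℝ) : ℂ) + rho * u) ≠ 0 := by
  have h := le_norm_den_half n u
  have hm : 1 ≤ max 1 (Real.exp (-(√2 * Real.pi) * u)) := le_max_left _ _
  rw [← norm_pos_iff]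
  linarith

lemma den_eq_zero {z : ℂ} (h : den z = 0) : ∃ n : ℤ, z = n := by
  unfold den at h
  rw [sub_eq_zero, eq_comm, Complex.exp_eq_one_iff] at h
  obtain ⟨n, hn⟩ := h
  refine ⟨n, ?_⟩
  have hp : (2 * Real.pi * Complex.I : ℂ) ≠ 0 := Complex.two_pi_I_ne_zero
  apply mul_right_cancel₀ hp
  rw [← hn]; ring

lemma differentiable_den : Differentiable ℂ den := by unfold den; fun_prop

lemma den_add_intCast (z : ℂ) (n : ℤ) : den (z + n) = den z := by
  unfold den
  have : 2 * Complex.I * Real.pi * (z + n)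
      = 2 * Complex.I * Real.pi * z + n * (2 * Real.pi * Complex.I) := by ring
  rw [this, Complex.exp_add, Complex.exp_int_mul_two_pi_mul_I, mul_one]

/-- Simplicity of the zeros: `dslope den k` does not vanish at k. -/
lemma deriv_den_intCast (n : ℤ) : deriv den n ≠ 0 := by
  have h : HasDerivAt den (-(Complex.exp (2 * Complex.I * Real.pi * n)
      * (2 * Complex.I * Real.pi * 1))) n := by
    unfold den
    exact (((hasDerivAt_id (n : ℂ)).const_mul _).cexp).const_sub 1
  rw [h.deriv]
  simp [Real.pi_ne_zero, Complex.exp_ne_zero]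

lemma differentiableOn_chirp (s x : ℝ) : DifferentiableOn ℂ (chirp s x) Complex.slitPlane := by
  intro z hz
  apply DifferentiableAt.differentiableWithinAt
  unfold chirp
  refine DifferentiableAt.div (by fun_prop) ?_ ?_
  · exact (differentiableAt_id).cpow_const hz
  · rw [Complex.cpow_ne_zero_iff]
    left; exact Complex.slitPlane_ne_zero hz

lemma norm_chirp_line (s x c u : ℝ) :
    ‖chirp s x ((c : ℂ) + rho * u)‖
      = Real.exp (-(Real.pi * x) * u ^ 2 - √2 * Real.pi * x * c * u)
        / ‖(c : ℂ) + rho * u‖ ^ s := by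
  unfold chirp
  rw [norm_div, norm_exp_quadratic_line, Complex.norm_cpow_real]

/-- Gaussian decay of `chirp * e^{-2iπ m z}` along lines, uniformly in a strip. -/
lemma exists_gaussian_bound_chirp {s x : ℝ} (hs : 0 ≤ s) (hx : 0 < x) (m : ℕ) (a b : ℝ)
    (ha : 0 < a) :
    ∃ C, 0 ≤ C ∧ ∀ c ∈ Set.Icc a b, ∀ u : ℝ,
      ‖chirp s x ((c : ℂ) + rho * u)
        * (Complex.exp (2 * Complex.I * Real.pi * ((c : ℂ) + rho * u)))⁻¹ ^ m‖
        ≤ C * Real.exp (-(Real.pi * x / 2) * u ^ 2) := by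
  -- The worst linear rate in the strip: c ≤ b in the quadratic phase, plus m factors e^{-2iπz}.
  set A : ℝ := √2 * Real.pi * x * b + m * (√2 * Real.pi) with hA
  refine ⟨((a / √2) ^ s)⁻¹ * Real.exp (A ^ 2 / (2 * (Real.pi * x))), by positivity, ?_⟩
  intro c hc u
  have hc0 : 0 < c := ha.trans_le hc.1
  rw [norm_mul, norm_pow, norm_inv, norm_exp_linear_line, norm_chirp_line]
  have h1 : (‖(c : ℂ) + rho * u‖ ^ s)⁻¹ ≤ ((a / √2) ^ s)⁻¹ := by
    apply inv_anti₀ (by positivity)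
    apply Real.rpow_le_rpow (by positivity) _ hs
    refine le_trans ?_ (le_norm_line_left c u)
    rw [abs_of_pos hc0]
    gcongr
    exact hc.1
  have h2 := exp_linear_sub_sq_le A (δ := Real.pi * x) (by positivity) u
  have h3 : Real.exp (-(Real.pi * x) * u ^ 2 - √2 * Real.pi * x * c * u)
      * ((Real.exp (-(√2 * Real.pi) * u))⁻¹ ^ m) ≤ Real.exp (A * |u| - Real.pi * x * u ^ 2) := by
    rw [← Real.exp_neg, ← Real.exp_nat_mul, ← Real.exp_add, Real.exp_le_exp]
    have e1 : -(√2 * Real.pi * x * c * u) ≤ √2 * Real.pi * x * b * |u| := by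
      have h4 : √2 * Real.pi * x * c * (-u) ≤ √2 * Real.pi * x * c * |u| :=
        mul_le_mul_of_nonneg_left (neg_le_abs u) (by positivity)
      have h5 : √2 * Real.pi * x * c * |u| ≤ √2 * Real.pi * x * b * |u| := by
        gcongr; exact hc.2
      linarith
    have e2 : m * (√2 * Real.pi) * u ≤ m * (√2 * Real.pi) * |u| :=
      mul_le_mul_of_nonneg_left (le_abs_self u) (by positivity)
    rw [hA]
    linarith
  calc _ = (‖(c : ℂ) + rho * u‖ ^ s)⁻¹ * (Real.exp (-(Real.pi * x) * u ^ 2 - √2 * Real.pi * x * c * u)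
      * ((Real.exp (-(√2 * Real.pi) * u))⁻¹ ^ m)) := by ring
    _ ≤ ((a / √2) ^ s)⁻¹ * (Real.exp (A ^ 2 / (2 * (Real.pi * x)))
        * Real.exp (-(Real.pi * x / 2) * u ^ 2)) := by
      exact mul_le_mul h1 (h3.trans h2) (by positivity) (by positivity)
    _ = _ := by ring

lemma norm_div_den_le {c u : ℝ} (hu : 1 ≤ |u|) (w : ℂ) :
    ‖w / den ((c : ℂ) + rho * u)‖ ≤ 2 * ‖w‖ := by
  rw [norm_div]
  have h := half_le_norm_den (c := c) hu
  rw [div_le_iff₀ (by linarith)]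
  nlinarith [norm_nonneg w]

lemma continuous_chirp_line (s x : ℝ) {c : ℝ} (hc : 0 < c) :
    Continuous (fun u : ℝ => chirp s x ((c : ℂ) + rho * u)) := by
  refine (differentiableOn_chirp s x).continuousOn.comp_continuous (by fun_prop) ?_
  exact fun u => line_mem_slitPlane hc u

lemma continuous_den_line (c : ℝ) : Continuous (fun u : ℝ => den ((c : ℂ) + rho * u)) :=
  differentiable_den.continuous.comp (by fun_prop)

lemma integrable_chirp_div_den {s x : ℝ} (hs : 0 ≤ s) (hx : 0 < x) (n : ℕ) :
    Integrable (fun u : ℝ => chirp s x (((n + 1 / 2 : ℝ) : ℂ) + rho * u)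
      / den (((n + 1 / 2 : ℝ) : ℂ) + rho * u)) := by
  have hn : (0 : ℝ) < n + 1 / 2 := by positivity
  obtain ⟨C, hC, hb⟩ := exists_gaussian_bound_chirp hs hx 0 (n + 1 / 2) (n + 1 / 2) hn
  refine integrable_of_gaussian_bound ((continuous_chirp_line s x hn).div₀
    (continuous_den_line _) ?_) (C := 2 * C) (δ := Real.pi * x / 2) (by positivity) ?_
  · intro u
    exact_mod_cast den_half_ne_zero n u
  · intro u hu
    refine (norm_div_den_le hu _).trans ?_
    have := hb _ ⟨le_rfl, le_rfl⟩ u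
    rw [pow_zero, mul_one] at this
    linarith

/-! ### Residues at the integers by comparison with an explicit function -/

/-- The function `e^{iπ(z²+z)}`, which is multiplied by `e^{2iπz}` under `z ↦ z + 1`. -/
noncomputable def model (z : ℂ) : ℂ := Complex.exp (Complex.I * Real.pi * (z ^ 2 + z))

lemma differentiable_model : Differentiable ℂ model := by unfold model; fun_prop

lemma model_zero : model 0 = 1 := by simp [model]

lemma model_add_one (z : ℂ) :
    model (z + 1) = Complex.exp (2 * Complex.I * Real.pi * z) * model z := by
  unfold model
  have : Complex.I * Real.pi * ((z + 1) ^ 2 + (z + 1))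
      = 2 * Complex.I * Real.pi * z + Complex.I * Real.pi * (z ^ 2 + z)
        + (1 : ℤ) * (2 * Real.pi * Complex.I) := by push_cast; ring
  rw [this, Complex.exp_add, Complex.exp_int_mul_two_pi_mul_I, mul_one, Complex.exp_add]

lemma norm_model_line_le {c : ℝ} (hc : |c| ≤ 1 / 2) (u : ℝ) :
    ‖model ((c : ℂ) + rho * u)‖
      ≤ Real.exp ((√2 * Real.pi) ^ 2 / (2 * Real.pi)) * Real.exp (-(Real.pi / 2) * u ^ 2) := by
  refine le_trans ?_ (exp_linear_sub_sq_le (√2 * Real.pi) Real.pi_pos u)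
  unfold model
  rw [Complex.norm_exp, Real.exp_le_exp]
  have : Complex.I * Real.pi * (((c : ℂ) + rho * u) ^ 2 + ((c : ℂ) + rho * u))
      = (Real.pi : ℝ) * (Complex.I * (((c : ℂ) + rho * u) ^ 2 + ((c : ℂ) + rho * u))) := by ring
  rw [this, Complex.re_ofReal_mul, Complex.I_mul_re, Complex.add_im, pow_two, Complex.mul_im,
    line_re, line_im]
  have h2 : √2 * √2 = 2 := Real.mul_self_sqrt (by norm_num)
  have e : Real.pi * -((c + √2 / 2 * u) * (√2 / 2 * u) + √2 / 2 * u * (c + √2 / 2 * u) + √2 / 2 * u)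
      = √2 * Real.pi * (-(c + 1 / 2) * u) - Real.pi * u ^ 2 := by
    linear_combination (-(Real.pi * u ^ 2 / 2)) * h2
  rw [e]
  have h3 : -(c + 1 / 2) * u ≤ |u| := by
    have h4 := abs_le.mp hc
    calc -(c + 1 / 2) * u = (c + 1 / 2) * (-u) := by ring
      _ ≤ (c + 1 / 2) * |u| := mul_le_mul_of_nonneg_left (neg_le_abs u) (by linarith)
      _ ≤ 1 * |u| := mul_le_mul_of_nonneg_right (by linarith) (abs_nonneg u)
      _ = |u| := one_mul _
  have : √2 * Real.pi * (-(c + 1 / 2) * u) ≤ √2 * Real.pi * |u| :=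
    mul_le_mul_of_nonneg_left h3 (by positivity)
  linarith

lemma integrable_model_div_den {c : ℝ} (n : ℤ) (hn : c = n + 1 / 2) (hc : |c| ≤ 1 / 2) :
    Integrable (fun u : ℝ => model ((c : ℂ) + rho * u) / den ((c : ℂ) + rho * u)) := by
  refine integrable_of_gaussian_bound
    ((differentiable_model.continuous.comp (by fun_prop)).div₀ (continuous_den_line _) ?_)
    (C := 2 * Real.exp ((√2 * Real.pi) ^ 2 / (2 * Real.pi))) (δ := Real.pi / 2) (by positivity) ?_
  · intro u
    rw [hn]
    exact den_half_ne_zero n u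
  · intro u hu
    refine (norm_div_den_le hu _).trans ?_
    have := norm_model_line_le hc u
    linarith

/-- The residue at 0, computed by hand. As `den` has period 1 and model(z) - model(z + 1) = den(z)
model(z), the integrands differ by model(z). On the left line z² + z = iu² - 1/4, so this is
ρ⁻¹e^{-πu²}. -/
lemma integral_model_div_den :
    (∫ u : ℝ, model (((-1 / 2 : ℝ) : ℂ) + rho * u) / den (((-1 / 2 : ℝ) : ℂ) + rho * u))
      - (∫ u : ℝ, model (((1 / 2 : ℝ) : ℂ) + rho * u) / den (((1 / 2 : ℝ) : ℂ) + rho * u))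
      = rho⁻¹ := by
  rw [← integral_sub (integrable_model_div_den (-1) (by norm_num) (by norm_num [abs_le]))
    (integrable_model_div_den 0 (by norm_num) (by norm_num [abs_le]))]
  have h : ∀ u : ℝ, model (((-1 / 2 : ℝ) : ℂ) + rho * u) / den (((-1 / 2 : ℝ) : ℂ) + rho * u)
      - model (((1 / 2 : ℝ) : ℂ) + rho * u) / den (((1 / 2 : ℝ) : ℂ) + rho * u)
      = rho⁻¹ * ((Real.exp (-Real.pi * u ^ 2) : ℝ) : ℂ) := by
    intro u
    set z := ((-1 / 2 : ℝ) : ℂ) + rho * u with hz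
    have e1 : ((1 / 2 : ℝ) : ℂ) + rho * u = z + 1 := by rw [hz]; push_cast; ring
    have hden : den z ≠ 0 := by
      have := den_half_ne_zero (-1) u
      have e : (((-1 : ℤ) + 1 / 2 : ℝ) : ℂ) + rho * u = z := by rw [hz]; push_cast; ring
      rwa [e] at this
    have hd1 : den (z + 1) = den z := by simpa using den_add_intCast z 1
    rw [e1, hd1, model_add_one]
    have : model z = rho⁻¹ * ((Real.exp (-Real.pi * u ^ 2) : ℝ) : ℂ) := by
      unfold model rho
      rw [← Complex.exp_neg, Complex.ofReal_exp, ← Complex.exp_add]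
      congr 1
      have hr : z ^ 2 + z = Complex.I * u ^ 2 - 1 / 4 := by
        have := rho_sq
        rw [hz]; push_cast
        linear_combination (u : ℂ) ^ 2 * this
      rw [hr]; push_cast
      linear_combination (Real.pi : ℂ) * u ^ 2 * Complex.I_sq
    rw [← this, ← sub_div, div_eq_iff hden]
    unfold den; ring
  simp only [h]
  rw [integral_const_mul, integral_complex_ofReal, integral_gaussian, div_self Real.pi_ne_zero]
  simp

/-- Moving the contour across the pole at `k` picks up the `k`-th term of the series. -/
lemma integral_chirp_div_den_succ {s x : ℝ} (hs : 0 ≤ s) (hx : 0 < x) (n : ℕ) :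
    (∫ u : ℝ, chirp s x (((n + 1 / 2 : ℝ) : ℂ) + rho * u) / den (((n + 1 / 2 : ℝ) : ℂ) + rho * u))
      - (∫ u : ℝ, chirp s x ((((n + 1 : ℕ) + 1 / 2 : ℝ) : ℂ) + rho * u)
          / den ((((n + 1 : ℕ) + 1 / 2 : ℝ) : ℂ) + rho * u))
      = rho⁻¹ * chirp s x ((n + 1 : ℕ) : ℂ) := by
  set k : ℂ := ((n + 1 : ℕ) : ℂ) with hk
  have hkz : k = (((n + 1 : ℕ) : ℤ) : ℂ) := by rw [hk]; push_cast; rfl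
  set a : ℝ := n + 1 / 2 with ha
  set b : ℝ := (n + 1 : ℕ) + 1 / 2 with hb'
  have ha0 : 0 < a := by rw [ha]; positivity
  have hab : a ≤ b := by rw [ha, hb']; push_cast; linarith
  -- Subtracting the model centred at k, scaled by the value of `chirp` there, kills the numerator
  -- at the pole.
  let P : ℂ → ℂ := fun z => chirp s x z - chirp s x k * model (z - k)
  have hkmem : k ∈ Complex.slitPlane := by
    rw [hk]; exact Complex.natCast_mem_slitPlane.mpr (Nat.succ_ne_zero n)
  have hPd : DifferentiableOn ℂ P Complex.slitPlane :=
    (differentiableOn_chirp s x).sub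
      ((differentiable_model.comp (differentiable_id.sub_const k)).differentiableOn.const_mul _)
  have hPk : P k = 0 := by simp [P, model_zero]
  have hdk : den k = 0 := by
    rw [hkz, ← zero_add (((((n + 1 : ℕ) : ℤ)) : ℂ)), den_add_intCast]
    simp [den]
  -- The analytic continuation of P / den across k.
  let D : ℂ → ℂ := fun z => dslope P k z / dslope den k z
  have hDne : ∀ z, z ≠ k → D z = P z / den z := by
    intro z hz
    have hz' : z - k ≠ 0 := sub_ne_zero.mpr hz
    simp only [D, dslope_of_ne _ hz, slope_def_field, hPk, hdk, sub_zero]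
    exact div_div_div_cancel_right₀ hz' _ _
  -- The strip n + 1/2 ≤ c ≤ n + 3/2 meets the integers only at k = n + 1.
  have hdsl : ∀ c ∈ Set.Icc a b, ∀ u : ℝ, dslope den k ((c : ℂ) + rho * u) ≠ 0 := by
    intro c hc u
    set z := (c : ℂ) + rho * u with hz
    by_cases hzk : z = k
    · rw [hzk, dslope_same, hkz]
      exact deriv_den_intCast _
    · rw [dslope_of_ne _ hzk, slope_def_field, hdk, sub_zero]
      refine div_ne_zero ?_ (sub_ne_zero.mpr hzk)
      intro h0
      obtain ⟨m, hm⟩ := den_eq_zero h0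
      have him : √2 / 2 * u = 0 := by rw [← line_im c u, ← hz, hm]; simp
      have hu : u = 0 := by
        have : √2 / 2 ≠ 0 := by positivity
        simpa [this] using him
      have hcm : c = m := by
        have := congrArg Complex.re hm
        rw [hz, line_re, hu] at this
        simpa using this
      have h1 : (n : ℤ) < m := by
        have : (n : ℝ) < m := by rw [← hcm]; linarith [hc.1]
        exact_mod_cast this
      have h2 : m < (n : ℤ) + 2 := by
        have : (m : ℝ) < n + 2 := by
          have := hc.2
          rw [hb'] at this; push_cast at this
          rw [← hcm]; linarith
        exact_mod_cast this
      have h3 : m = ((n + 1 : ℕ) : ℤ) := by push_cast; omega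
      exact hzk (by rw [hm, h3, hkz])
  have hDa : ∀ c ∈ Set.Icc a b, ∀ u : ℝ, AnalyticAt ℂ D ((c : ℂ) + rho * u) := by
    intro c hc u
    have hzs := line_mem_slitPlane (ha0.trans_le hc.1) u
    refine AnalyticAt.div ?_ ?_ (hdsl c hc u)
    · exact ((Complex.differentiableOn_dslope (Complex.isOpen_slitPlane.mem_nhds hkmem)).mpr
        hPd).analyticAt (Complex.isOpen_slitPlane.mem_nhds hzs)
    · exact ((Complex.differentiableOn_dslope (s := Set.univ) Filter.univ_mem).mpr
        differentiable_den.differentiableOn).analyticAt Filter.univ_mem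
  have hsub : ∀ c u : ℝ, (c : ℂ) + rho * u - k = ((c - (n + 1) : ℝ) : ℂ) + rho * u := by
    intro c u; rw [hk]; push_cast; ring
  obtain ⟨C, hC, hb⟩ := exists_gaussian_bound_chirp hs hx 0 a b ha0
  set M := Real.exp ((√2 * Real.pi) ^ 2 / (2 * Real.pi)) with hM
  set δ := min (Real.pi * x / 2) (Real.pi / 2) with hδ
  have hδ0 : 0 < δ := by rw [hδ]; exact lt_min (by positivity) (by positivity)
  have hshift := line_shift (G := D) hab hDa (C := 2 * (C + ‖chirp s x k‖ * M)) hδ0 (by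
    intro c hc u hu
    have hne : (c : ℂ) + rho * u ≠ k := by
      intro h
      have him : √2 / 2 * u = 0 := by rw [← line_im c u, h, hk]; simp
      have : √2 / 2 ≠ 0 := by positivity
      have hu0 : u = 0 := by simpa [this] using him
      rw [hu0] at hu; norm_num at hu
    rw [hDne _ hne]
    refine (norm_div_den_le hu _).trans ?_
    have h1 := hb c hc u
    rw [pow_zero, mul_one] at h1
    have h2 : ‖model ((c : ℂ) + rho * u - k)‖ ≤ M * Real.exp (-(Real.pi / 2) * u ^ 2) := by
      rw [hsub]
      apply norm_model_line_le
      have h3 := hc.1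
      have h4 := hc.2
      rw [hb'] at h4; push_cast at h4
      rw [abs_le]; constructor <;> linarith
    have h3 : ‖P ((c : ℂ) + rho * u)‖ ≤ C * Real.exp (-(Real.pi * x / 2) * u ^ 2)
        + ‖chirp s x k‖ * (M * Real.exp (-(Real.pi / 2) * u ^ 2)) := by
      refine (norm_sub_le _ _).trans ?_
      rw [norm_mul]
      gcongr
    have e1 : Real.exp (-(Real.pi * x / 2) * u ^ 2) ≤ Real.exp (-δ * u ^ 2) := by
      rw [Real.exp_le_exp]
      have := mul_le_mul_of_nonneg_right (min_le_left (Real.pi * x / 2) (Real.pi / 2)) (sq_nonneg u)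
      rw [← hδ] at this; linarith
    have e2 : Real.exp (-(Real.pi / 2) * u ^ 2) ≤ Real.exp (-δ * u ^ 2) := by
      rw [Real.exp_le_exp]
      have := mul_le_mul_of_nonneg_right (min_le_right (Real.pi * x / 2) (Real.pi / 2)) (sq_nonneg u)
      rw [← hδ] at this; linarith
    have hM0 : 0 ≤ M := (Real.exp_pos _).le
    calc 2 * ‖P ((c : ℂ) + rho * u)‖ ≤ 2 * (C * Real.exp (-δ * u ^ 2)
        + ‖chirp s x k‖ * (M * Real.exp (-δ * u ^ 2))) := by
          have : C * Real.exp (-(Real.pi * x / 2) * u ^ 2)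
            + ‖chirp s x k‖ * (M * Real.exp (-(Real.pi / 2) * u ^ 2))
            ≤ C * Real.exp (-δ * u ^ 2) + ‖chirp s x k‖ * (M * Real.exp (-δ * u ^ 2)) := by gcongr
          linarith
      _ = _ := by ring)
  -- Used on both boundary lines. The D-parts agree by the contour shift, so the difference is
  -- carried by the model integrals, translated by k to the lines through -1/2 and 1/2.
  have hsplit : ∀ c : ℝ, ∀ m : ℕ, c = m + 1 / 2 → ∀ l : ℤ, c - (n + 1) = l + 1 / 2 →
      |c - (n + 1)| ≤ 1 / 2 →
      ∫ u : ℝ, chirp s x ((c : ℂ) + rho * u) / den ((c : ℂ) + rho * u)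
        = (∫ u : ℝ, D ((c : ℂ) + rho * u))
          + chirp s x k * ∫ u : ℝ, model (((c - (n + 1) : ℝ) : ℂ) + rho * u)
            / den (((c - (n + 1) : ℝ) : ℂ) + rho * u) := by
    intro c m hm l hl hlc
    have hne : ∀ u : ℝ, (c : ℂ) + rho * u ≠ k := by
      intro u h
      have := den_half_ne_zero (m : ℤ) u
      rw [show (((m : ℤ) : ℝ) + 1 / 2) = c by rw [hm]; push_cast; ring, h] at this
      exact this hdk
    have hdd : ∀ u : ℝ, den (((c - (n + 1) : ℝ) : ℂ) + rho * u) = den ((c : ℂ) + rho * u) := by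
      intro u
      rw [← hsub, hkz, ← den_add_intCast (_ - _) ((n + 1 : ℕ) : ℤ)]
      simp
    have i1 : Integrable (fun u : ℝ => chirp s x ((c : ℂ) + rho * u) / den ((c : ℂ) + rho * u)) := by
      rw [hm]; exact integrable_chirp_div_den hs hx m
    have i2 := (integrable_model_div_den l hl hlc).const_mul (chirp s x k)
    rw [← integral_const_mul, ← sub_eq_iff_eq_add, ← integral_sub i1 i2]
    congr 1
    ext u
    rw [hDne _ (hne u), hdd, ← hsub]
    simp only [P]
    ring
  rw [hsplit a n ha (-1) (by rw [ha]; push_cast; ring) (by rw [ha]; ring_nf; norm_num [abs_le]),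
    hsplit b (n + 1) hb' 0 (by rw [hb']; push_cast; ring) (by rw [hb']; push_cast; ring_nf; norm_num [abs_le]),
    hshift]
  have e1 : a - (n + 1) = -1 / 2 := by rw [ha]; ring
  have e2 : b - (n + 1) = 1 / 2 := by rw [hb']; push_cast; ring
  rw [e1, e2]
  linear_combination chirp s x k * integral_model_div_den

/-! ### Partial sums as contour integrals -/

lemma partialF_zero (s : ℝ) (n : ℕ) (x : ℝ) :
    partialF s n x 0 = ∑ k ∈ Finset.range n, chirp s x ((k + 1 : ℕ) : ℂ) := by
  unfold partialF chirp
  rw [Finset.range_eq_Ico, Finset.sum_Ico_add' (fun k : ℕ =>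
    Complex.exp (Complex.I * Real.pi * (k : ℂ) ^ 2 * x) / (k : ℂ) ^ (s : ℂ)) 0 n 1]
  refine Finset.sum_congr (by ext; simp) fun k _ => ?_
  simp

/-- The pole crossings telescope; the factor ρ comes from dz = ρ du. -/
lemma partialF_eq_integral_sub {s x : ℝ} (hs : 0 ≤ s) (hx : 0 < x) (n : ℕ) :
    partialF s n x 0
      = rho * ((∫ u : ℝ, chirp s x (((1 / 2 : ℝ) : ℂ) + rho * u) / den (((1 / 2 : ℝ) : ℂ) + rho * u))
        - ∫ u : ℝ, chirp s x (((n + 1 / 2 : ℝ) : ℂ) + rho * u)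
            / den (((n + 1 / 2 : ℝ) : ℂ) + rho * u)) := by
  induction n with
  | zero => simp [partialF]
  | succ n ih =>
    rw [partialF_zero, Finset.sum_range_succ, ← partialF_zero, ih]
    have h := integral_chirp_div_den_succ hs hx n
    have hr := mul_inv_cancel₀ rho_ne_zero
    linear_combination (-rho) * h - chirp s x ((n + 1 : ℕ) : ℂ) * hr

/-! ### Saddle point contributions -/

lemma ofReal_mul_cpow_ofReal {r : ℝ} (hr : 0 < r) {z : ℂ} (hz : z ≠ 0) (s : ℝ) :
    ((r : ℂ) * z) ^ (s : ℂ) = ((r ^ s : ℝ) : ℂ) * z ^ (s : ℂ) := by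
  have hr' : (r : ℂ) ≠ 0 := by exact_mod_cast hr.ne'
  rw [Complex.cpow_def_of_ne_zero (mul_ne_zero hr' hz), Complex.cpow_def_of_ne_zero hz,
    Complex.log_ofReal_mul hr hz, Complex.ofReal_cpow hr.le, Complex.cpow_def_of_ne_zero hr',
    ← Complex.ofReal_log hr.le, ← Complex.exp_add, add_mul]

/-- The `k`-th summand of `innerSeries` at `t = 0`. -/
noncomputable def innerTerm (s x : ℝ) (k : ℕ) (u : ℝ) : ℂ :=
  Complex.exp (-Complex.I * Real.pi * ((k : ℂ) + 1) ^ 2 / x)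
    * (1 / (rho * x * u + ((k : ℂ) + 1)) ^ (s : ℂ) - 1 / ((k : ℂ) + 1) ^ (s : ℂ))

lemma innerSeries_zero (s x u : ℝ) : innerSeries s x 0 u = ∑' k : ℕ, innerTerm s x k u := by
  simp [innerSeries, innerTerm]

/-- Mean value estimate for `z ↦ z^{-s}` along a line. -/
lemma norm_one_div_cpow_sub_le {s : ℝ} (hs0 : 0 ≤ s) (hs1 : s ≤ 1) {k : ℝ} (hk : 0 < k) (v : ℝ) :
    ‖1 / ((k : ℂ) + rho * v) ^ (s : ℂ) - 1 / (k : ℂ) ^ (s : ℂ)‖ ≤ 2 / k ^ (s + 1) * |v| := by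
  let f : ℝ → ℂ := fun t => ((k : ℂ) + rho * t) ^ (-(s : ℂ))
  have hd : ∀ t : ℝ, HasDerivAt f (-(s : ℂ) * ((k : ℂ) + rho * t) ^ (-(s : ℂ) - 1) * rho) t := by
    intro t
    have h1 : HasDerivAt (fun t : ℝ => (k : ℂ) + rho * t) (rho * 1) t :=
      ((Complex.ofRealCLM.hasDerivAt (x := t)).const_mul rho).const_add _
    rw [mul_one] at h1
    have h2 := (hasDerivAt_id ((k : ℂ) + rho * t)).cpow_const (c := -(s : ℂ))
      (line_mem_slitPlane hk t)
    have := h2.comp t h1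
    rw [mul_one] at this
    exact this
  have hbound : ∀ t : ℝ, ‖deriv f t‖ ≤ 2 / k ^ (s + 1) := by
    intro t
    rw [(hd t).deriv, norm_mul, norm_mul, norm_rho, mul_one, norm_neg, Complex.norm_real,
      Real.norm_of_nonneg hs0]
    have e : (-(s : ℂ) - 1) = ((-(s + 1) : ℝ) : ℂ) := by push_cast; ring
    rw [e, Complex.norm_cpow_real, Real.rpow_neg (norm_nonneg _)]
    -- The line stays at distance at least k/√2 from 0, and √2^{s+1} ≤ 2 accounts for the constant.
    have h1 : (k / √2) ^ (s + 1) ≤ ‖(k : ℂ) + rho * t‖ ^ (s + 1) := by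
      apply Real.rpow_le_rpow (by positivity) _ (by linarith)
      have := le_norm_line_left k t
      rwa [abs_of_pos hk] at this
    have h2 : √2 ^ (s + 1) ≤ 2 := by
      calc √2 ^ (s + 1) ≤ √2 ^ (2 : ℝ) :=
            Real.rpow_le_rpow_of_exponent_le one_le_sqrt_two (by linarith)
        _ = 2 := by norm_num
    have h3 : (0 : ℝ) < k ^ (s + 1) := by positivity
    have h4 : (0 : ℝ) < √2 ^ (s + 1) := by positivity
    calc s * (‖(k : ℂ) + rho * t‖ ^ (s + 1))⁻¹ ≤ 1 * ((k / √2) ^ (s + 1))⁻¹ := by gcongr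
      _ = √2 ^ (s + 1) / k ^ (s + 1) := by
        rw [Real.div_rpow hk.le (by positivity), one_mul, inv_div]
      _ ≤ 2 / k ^ (s + 1) := by gcongr
  have := convex_univ.norm_image_sub_le_of_norm_deriv_le (f := f) (x := 0) (y := v)
    (fun t _ => (hd t).differentiableAt) (fun t _ => hbound t) (Set.mem_univ _) (Set.mem_univ _)
  simpa [f, Complex.cpow_neg] using this

/-- The exponential is unimodular, and subtracting k^{-s} gains a factor 1/k. This makes the series
absolutely convergent for every s > 0. -/
lemma norm_innerTerm_le {s x : ℝ} (hs0 : 0 ≤ s) (hs1 : s ≤ 1) (hx : 0 < x) (k : ℕ) (u : ℝ) :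
    ‖innerTerm s x k u‖ ≤ 2 * x * |u| * (1 / ((k + 1 : ℕ) : ℝ) ^ (s + 1)) := by
  unfold innerTerm
  have h1 : ‖Complex.exp (-Complex.I * Real.pi * ((k : ℂ) + 1) ^ 2 / x)‖ = 1 := by
    have : -Complex.I * Real.pi * ((k : ℂ) + 1) ^ 2 / x
        = ((-Real.pi * (k + 1) ^ 2 / x : ℝ) : ℂ) * Complex.I := by push_cast; ring
    rw [this, Complex.norm_exp_ofReal_mul_I]
  rw [norm_mul, h1, one_mul]
  have h2 := norm_one_div_cpow_sub_le hs0 hs1 (k := ((k + 1 : ℕ) : ℝ)) (by positivity) (x * u)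
  have e : rho * x * u + ((k : ℂ) + 1) = (((k + 1 : ℕ) : ℝ) : ℂ) + rho * ((x * u : ℝ) : ℂ) := by
    push_cast; ring
  have e2 : ((k : ℂ) + 1) = (((k + 1 : ℕ) : ℝ) : ℂ) := by push_cast; ring
  rw [e, e2]
  refine h2.trans (le_of_eq ?_)
  rw [abs_mul, abs_of_pos hx]; ring

lemma continuous_innerTerm (s x : ℝ) (k : ℕ) : Continuous (innerTerm s x k) := by
  unfold innerTerm
  refine continuous_const.mul (Continuous.sub ?_ continuous_const)
  have hmem : ∀ u : ℝ, rho * x * u + ((k : ℂ) + 1) ∈ Complex.slitPlane := by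
    intro u
    have := line_mem_slitPlane (c := (k : ℝ) + 1) (by positivity) (x * u)
    convert this using 1
    push_cast; ring
  refine continuous_const.div₀ ?_ ?_
  · exact Continuous.cpow (by fun_prop) continuous_const (fun u => hmem u)
  · intro u
    rw [Complex.cpow_ne_zero_iff]
    left; exact Complex.slitPlane_ne_zero (hmem u)

lemma integrable_abs_mul_gaussian {x : ℝ} (hx : 0 < x) :
    Integrable (fun u : ℝ => |u| * Real.exp (-(Real.pi * x) * u ^ 2)) := by
  have := (integrable_mul_exp_neg_mul_sq (b := Real.pi * x) (by positivity)).norm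
  simpa [abs_mul] using this

lemma norm_cexp_gaussian (x u : ℝ) :
    ‖Complex.exp (-Real.pi * x * (u : ℂ) ^ 2)‖ = Real.exp (-(Real.pi * x) * u ^ 2) := by
  have : (-Real.pi * x * (u : ℂ) ^ 2) = ((-(Real.pi * x) * u ^ 2 : ℝ) : ℂ) := by push_cast; ring
  rw [this, ← Complex.ofReal_exp, Complex.norm_real, Real.norm_of_nonneg (Real.exp_pos _).le]

lemma integrable_gaussian_mul_innerTerm {s x : ℝ} (hs0 : 0 ≤ s) (hs1 : s ≤ 1) (hx : 0 < x)
    (k : ℕ) :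
    Integrable (fun u : ℝ => Complex.exp (-Real.pi * x * (u : ℂ) ^ 2) * innerTerm s x k u) := by
  refine ((integrable_abs_mul_gaussian hx).const_mul
    (2 * x * (1 / ((k + 1 : ℕ) : ℝ) ^ (s + 1)))).mono'
    (Continuous.aestronglyMeasurable (by
      refine Continuous.mul (by fun_prop) (continuous_innerTerm s x k))) ?_
  refine Eventually.of_forall fun u => ?_
  rw [norm_mul, norm_cexp_gaussian]
  have := norm_innerTerm_le hs0 hs1 hx k u
  have h2 := mul_le_mul_of_nonneg_left this (Real.exp_pos (-(Real.pi * x) * u ^ 2)).le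
  refine h2.trans (le_of_eq (by ring))

lemma integral_cexp_gaussian {x : ℝ} (hx : 0 < x) :
    ∫ u : ℝ, Complex.exp (-Real.pi * x * (u : ℂ) ^ 2) = ((x ^ (-(1 / 2) : ℝ) : ℝ) : ℂ) := by
  have h : ∀ u : ℝ, Complex.exp (-Real.pi * x * (u : ℂ) ^ 2)
      = ((Real.exp (-(Real.pi * x) * u ^ 2) : ℝ) : ℂ) := by
    intro u; push_cast; congr 1; ring
  simp only [h]
  rw [integral_complex_ofReal, integral_gaussian, div_mul_cancel_left₀ Real.pi_ne_zero,
    Real.sqrt_inv, Real.sqrt_eq_rpow, Real.rpow_neg hx.le]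

lemma integrable_cexp_gaussian {x : ℝ} (hx : 0 < x) :
    Integrable (fun u : ℝ => Complex.exp (-Real.pi * x * (u : ℂ) ^ 2)) := by
  have := integrable_cexp_neg_mul_sq (b := ((Real.pi * x : ℝ) : ℂ)) (by
    rw [Complex.ofReal_re]; positivity)
  refine this.congr (Eventually.of_forall fun u => ?_)
  simp only; congr 1; push_cast; ring

lemma integrable_chirp_mul_exp {s x : ℝ} (hs : 0 ≤ s) (hx : 0 < x) (m : ℕ) {c : ℝ} (hc : 0 < c) :
    Integrable (fun u : ℝ => chirp s x ((c : ℂ) + rho * u)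
      * (Complex.exp (2 * Complex.I * Real.pi * ((c : ℂ) + rho * u)))⁻¹ ^ m) := by
  obtain ⟨C, hC, hb⟩ := exists_gaussian_bound_chirp hs hx m c c hc
  refine integrable_of_gaussian_bound (δ := Real.pi * x / 2) ?_ (by positivity)
    (fun u _ => hb c ⟨le_rfl, le_rfl⟩ u)
  refine (continuous_chirp_line s x hc).mul (Continuous.pow (Continuous.inv₀ (by fun_prop) ?_) m)
  exact fun u => Complex.exp_ne_zero _

/-- The contribution of the `k`-th saddle point. -/
lemma integral_chirp_mul_exp {s x : ℝ} (hs0 : 0 ≤ s) (hs1 : s ≤ 1) (hx : 0 < x) (k : ℕ) {c : ℝ}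
    (hc : 0 < c) :
    ∫ u : ℝ, chirp s x ((c : ℂ) + rho * u)
      * (Complex.exp (2 * Complex.I * Real.pi * ((c : ℂ) + rho * u)))⁻¹ ^ (k + 1)
    = ((x ^ s : ℝ) : ℂ) * (∫ u : ℝ, Complex.exp (-Real.pi * x * (u : ℂ) ^ 2) * innerTerm s x k u)
      + ((x ^ (s - 1 / 2) : ℝ) : ℂ) * chirp s (-1 / x) ((k + 1 : ℕ) : ℂ) := by
  have hshift : ∀ a b : ℝ, 0 < a → a ≤ b →
      ∫ u : ℝ, chirp s x ((a : ℂ) + rho * u)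
        * (Complex.exp (2 * Complex.I * Real.pi * ((a : ℂ) + rho * u)))⁻¹ ^ (k + 1)
      = ∫ u : ℝ, chirp s x ((b : ℂ) + rho * u)
        * (Complex.exp (2 * Complex.I * Real.pi * ((b : ℂ) + rho * u)))⁻¹ ^ (k + 1) := by
    intro a b ha hab
    obtain ⟨C, hC, hb⟩ := exists_gaussian_bound_chirp hs0 hx (k + 1) a b ha
    refine line_shift (G := fun z => chirp s x z
      * (Complex.exp (2 * Complex.I * Real.pi * z))⁻¹ ^ (k + 1)) hab ?_
      (δ := Real.pi * x / 2) (by positivity) (fun c hc u _ => hb c hc u)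
    intro c hc u
    have hm := line_mem_slitPlane (ha.trans_le hc.1) u
    have hd : Differentiable ℂ fun z : ℂ =>
        (Complex.exp (2 * Complex.I * Real.pi * z))⁻¹ ^ (k + 1) := by
      simp only [← Complex.exp_neg]
      fun_prop
    exact ((differentiableOn_chirp s x).analyticAt
      (Complex.isOpen_slitPlane.mem_nhds hm)).mul (hd.analyticAt _)
  -- The stationary point of the phase πxz² - 2π(k+1)z.
  set p : ℝ := ((k : ℝ) + 1) / x with hp
  have hp0 : 0 < p := by positivity
  have hxc : (x : ℂ) ≠ 0 := by exact_mod_cast hx.ne'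
  have h1 : ∫ u : ℝ, chirp s x ((c : ℂ) + rho * u)
      * (Complex.exp (2 * Complex.I * Real.pi * ((c : ℂ) + rho * u)))⁻¹ ^ (k + 1)
      = ∫ u : ℝ, chirp s x ((p : ℂ) + rho * u)
      * (Complex.exp (2 * Complex.I * Real.pi * ((p : ℂ) + rho * u)))⁻¹ ^ (k + 1) := by
    rcases le_total c p with h | h
    · exact hshift c p hc h
    · exact (hshift p c hp0 h).symm
  -- At the saddle the exponent is exactly -iπ(k+1)²/x - πxu², and p + ρu = (k + 1 + ρxu)/x yields
  -- the factor x^s. Splitting off the value of the power at u = 0 separates `innerTerm` from a pure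
  -- Gaussian, whose integral x^{-1/2} turns x^s into x^{s-1/2}.
  have h2 : ∀ u : ℝ, chirp s x ((p : ℂ) + rho * u)
      * (Complex.exp (2 * Complex.I * Real.pi * ((p : ℂ) + rho * u)))⁻¹ ^ (k + 1)
      = ((x ^ s : ℝ) : ℂ) * (Complex.exp (-Real.pi * x * (u : ℂ) ^ 2) * innerTerm s x k u)
        + ((x ^ s : ℝ) : ℂ) * chirp s (-1 / x) ((k + 1 : ℕ) : ℂ)
          * Complex.exp (-Real.pi * x * (u : ℂ) ^ 2) := by
    intro u
    have hne : rho * x * u + ((k : ℂ) + 1) ≠ 0 := by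
      have := line_mem_slitPlane (c := (k : ℝ) + 1) (by positivity) (x * u)
      have h3 := Complex.slitPlane_ne_zero this
      convert h3 using 1
      push_cast; ring
    have hz : (p : ℂ) + rho * u = ((x⁻¹ : ℝ) : ℂ) * (rho * x * u + ((k : ℂ) + 1)) := by
      rw [hp]; push_cast; field_simp; ring
    have hpow : ((p : ℂ) + rho * u) ^ (s : ℂ)
        = (((x ^ s : ℝ) : ℂ))⁻¹ * (rho * x * u + ((k : ℂ) + 1)) ^ (s : ℂ) := by
      rw [hz, ofReal_mul_cpow_ofReal (by positivity) hne, Real.inv_rpow hx.le, Complex.ofReal_inv]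
    have hexp : Complex.exp (Complex.I * Real.pi * ((p : ℂ) + rho * u) ^ 2 * x)
        * (Complex.exp (2 * Complex.I * Real.pi * ((p : ℂ) + rho * u)))⁻¹ ^ (k + 1)
        = Complex.exp (-Complex.I * Real.pi * ((k : ℂ) + 1) ^ 2 / x)
          * Complex.exp (-Real.pi * x * (u : ℂ) ^ 2) := by
      rw [← Complex.exp_neg, ← Complex.exp_nat_mul, ← Complex.exp_add, ← Complex.exp_add]
      congr 1
      rw [hp]
      push_cast
      have hr := rho_sq
      field_simp
      have hI := Complex.I_sq
      linear_combination (Complex.I * x ^ 2 * u ^ 2) * hr + (x ^ 2 * u ^ 2 : ℂ) * hI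
    have e3 : Complex.exp (Complex.I * Real.pi * (((k + 1 : ℕ) : ℂ)) ^ 2 * ((-1 / x : ℝ) : ℂ))
        = Complex.exp (-Complex.I * Real.pi * ((k : ℂ) + 1) ^ 2 / x) := by
      congr 1; push_cast; ring
    have hpow0 : (rho * x * u + ((k : ℂ) + 1)) ^ (s : ℂ) ≠ 0 := by
      rw [Complex.cpow_ne_zero_iff]; left; exact hne
    have hxs : ((x ^ s : ℝ) : ℂ) ≠ 0 := by
      exact_mod_cast (Real.rpow_pos_of_pos hx s).ne'
    have hc1 : ((k + 1 : ℕ) : ℂ) = (k : ℂ) + 1 := by push_cast; ring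
    calc _ = ((x ^ s : ℝ) : ℂ) * (1 / (rho * x * u + ((k : ℂ) + 1)) ^ (s : ℂ))
          * (Complex.exp (Complex.I * Real.pi * ((p : ℂ) + rho * u) ^ 2 * x)
        * (Complex.exp (2 * Complex.I * Real.pi * ((p : ℂ) + rho * u)))⁻¹ ^ (k + 1)) := by
          unfold chirp
          rw [hpow]
          field_simp
      _ = _ := by
          rw [hexp]
          unfold chirp innerTerm
          rw [e3, hc1]
          ring
  rw [h1]
  simp only [h2]
  rw [integral_add ((integrable_gaussian_mul_innerTerm hs0 hs1 hx k).const_mul _)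
    ((integrable_cexp_gaussian hx).const_mul _), integral_const_mul, integral_const_mul,
    integral_cexp_gaussian hx]
  have : ((x ^ (s - 1 / 2) : ℝ) : ℂ) = ((x ^ s : ℝ) : ℂ) * ((x ^ (-(1 / 2) : ℝ) : ℝ) : ℂ) := by
    rw [sub_eq_add_neg, Real.rpow_add hx]; push_cast; ring
  rw [this]; ring

/-! ### The exact finite transformation formula -/

/-- A finite geometric expansion in q⁻¹, q = e^{2iπz}: each power in the sum carries one saddle
point, and the tail q^{-m}/(1 - q) becomes the remainder. -/
lemma inv_den_eq {z : ℂ} (hz : den z ≠ 0) (m : ℕ) :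
    1 / den z = (Complex.exp (2 * Complex.I * Real.pi * z))⁻¹ ^ m / den z
      - ∑ k ∈ Finset.range m, (Complex.exp (2 * Complex.I * Real.pi * z))⁻¹ ^ (k + 1) := by
  induction m with
  | zero => simp
  | succ m ih =>
    rw [Finset.sum_range_succ, ih]
    have hq : Complex.exp (2 * Complex.I * Real.pi * z) ≠ 0 := Complex.exp_ne_zero _
    have hd : den z = 1 - Complex.exp (2 * Complex.I * Real.pi * z) := rfl
    rw [hd] at hz ⊢
    set q := Complex.exp (2 * Complex.I * Real.pi * z)
    have step : ∀ a : ℂ, a / (1 - q) = a * q⁻¹ / (1 - q) - a * q⁻¹ := by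
      intro a
      field_simp
      ring
    rw [step (q⁻¹ ^ m), ← pow_succ]
    ring

/-- The exact finite transformation formula. -/
lemma partialF_sub_partialF {s x : ℝ} (hs0 : 0 ≤ s) (hs1 : s ≤ 1) (hx : 0 < x) (n m : ℕ) :
    partialF s n x 0 - rho * ((x ^ (s - 1 / 2) : ℝ) : ℂ) * partialF s m (-1 / x) 0
      = rho * (∫ u : ℝ, chirp s x (((1 / 2 : ℝ) : ℂ) + rho * u) / den (((1 / 2 : ℝ) : ℂ) + rho * u))
        + rho * ((x ^ s : ℝ) : ℂ) * (∫ u : ℝ, Complex.exp (-Real.pi * x * (u : ℂ) ^ 2)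
            * ∑ k ∈ Finset.range m, innerTerm s x k u)
        - rho * ∫ u : ℝ, chirp s x (((n + 1 / 2 : ℝ) : ℂ) + rho * u)
            * (Complex.exp (2 * Complex.I * Real.pi * (((n + 1 / 2 : ℝ) : ℂ) + rho * u)))⁻¹ ^ m
            / den (((n + 1 / 2 : ℝ) : ℂ) + rho * u) := by
  have hn : (0 : ℝ) < n + 1 / 2 := by positivity
  have hden : ∀ u : ℝ, den (((n + 1 / 2 : ℝ) : ℂ) + rho * u) ≠ 0 := fun u => by
    exact_mod_cast den_half_ne_zero n u
  rw [partialF_eq_integral_sub hs0 hx]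
  have hsum : Integrable (fun u : ℝ => ∑ k ∈ Finset.range m,
      chirp s x (((n + 1 / 2 : ℝ) : ℂ) + rho * u)
      * (Complex.exp (2 * Complex.I * Real.pi * (((n + 1 / 2 : ℝ) : ℂ) + rho * u)))⁻¹ ^ (k + 1)) :=
    integrable_finsetSum _ fun k _ => integrable_chirp_mul_exp hs0 hx (k + 1) hn
  have key : ∀ u : ℝ, chirp s x (((n + 1 / 2 : ℝ) : ℂ) + rho * u)
            * (Complex.exp (2 * Complex.I * Real.pi * (((n + 1 / 2 : ℝ) : ℂ) + rho * u)))⁻¹ ^ m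
            / den (((n + 1 / 2 : ℝ) : ℂ) + rho * u)
      = chirp s x (((n + 1 / 2 : ℝ) : ℂ) + rho * u) / den (((n + 1 / 2 : ℝ) : ℂ) + rho * u)
        + ∑ k ∈ Finset.range m, chirp s x (((n + 1 / 2 : ℝ) : ℂ) + rho * u)
      * (Complex.exp (2 * Complex.I * Real.pi * (((n + 1 / 2 : ℝ) : ℂ) + rho * u)))⁻¹ ^ (k + 1) := by
    intro u
    have := inv_den_eq (hden u) m
    rw [← Finset.mul_sum]
    linear_combination (-chirp s x (((n + 1 / 2 : ℝ) : ℂ) + rho * u)) * this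
  have e2 : (∫ u : ℝ, Complex.exp (-Real.pi * x * (u : ℂ) ^ 2)
            * ∑ k ∈ Finset.range m, innerTerm s x k u)
      = ∑ k ∈ Finset.range m, ∫ u : ℝ, Complex.exp (-Real.pi * x * (u : ℂ) ^ 2)
          * innerTerm s x k u := by
    simp only [Finset.mul_sum]
    exact integral_finsetSum _ fun k _ => integrable_gaussian_mul_innerTerm hs0 hs1 hx k
  simp only [key]
  rw [integral_add (integrable_chirp_div_den hs0 hx n) hsum,
    integral_finsetSum _ fun k _ => integrable_chirp_mul_exp hs0 hx (k + 1) hn, e2]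
  simp only [integral_chirp_mul_exp hs0 hs1 hx _ hn]
  rw [Finset.sum_add_distrib, ← Finset.mul_sum, ← Finset.mul_sum, partialF_zero]
  ring

/-! ### Estimates for the remainder -/

/-- The integrand along the line through `n + 1/2` that remains after `m` saddle points have been
extracted. -/
noncomputable def remainder (s x : ℝ) (n m : ℕ) (u : ℝ) : ℂ :=
  chirp s x (((n + 1 / 2 : ℝ) : ℂ) + rho * u)
    * (Complex.exp (2 * Complex.I * Real.pi * (((n + 1 / 2 : ℝ) : ℂ) + rho * u)))⁻¹ ^ m
    / den (((n + 1 / 2 : ℝ) : ℂ) + rho * u)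

/-- With c = n + 1/2, the numerator has linear exponent √2π(m - xc)u, harmless for u ≥ 0 since m ≤
xc. For u ≤ 0 the denominator supplies one more factor, replacing m by m + 1. The slack x/2 is
absorbed by half of the Gaussian at the cost of e^{π/4}. -/
lemma norm_remainder_le {s x : ℝ} (hx : 0 < x) (hx1 : x ≤ 1) {n m : ℕ}
    (h0 : (m : ℝ) ≤ x * (n + 1 / 2)) (h1 : x * (n + 1 / 2) ≤ m + 1 + x / 2) (u : ℝ) :
    ‖remainder s x n m u‖ ≤ 2 * Real.exp (Real.pi / 4) * Real.exp (-(Real.pi * x / 2) * u ^ 2)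
      * (‖((n + 1 / 2 : ℝ) : ℂ) + rho * u‖ ^ s)⁻¹ := by
  set c : ℝ := n + 1 / 2 with hc
  have hc0 : 0 < c := by rw [hc]; positivity
  have hpi := Real.pi_pos
  have hden : max 1 (Real.exp (-(√2 * Real.pi) * u)) / 2 ≤ ‖den ((c : ℂ) + rho * u)‖ := by
    have := le_norm_den_half n u
    push_cast at this ⊢
    rw [hc]; push_cast; exact this
  have hmax : 0 < max 1 (Real.exp (-(√2 * Real.pi) * u)) := lt_max_of_lt_left one_pos
  have hN : 0 < ‖(c : ℂ) + rho * u‖ ^ s := by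
    apply Real.rpow_pos_of_pos
    exact norm_pos_iff.mpr (Complex.slitPlane_ne_zero (line_mem_slitPlane hc0 u))
  unfold remainder
  rw [← hc, norm_div, norm_mul, norm_pow, norm_inv, norm_exp_linear_line, norm_chirp_line,
    ← Real.exp_neg, ← Real.exp_nat_mul]
  have key : Real.exp (-(Real.pi * x) * u ^ 2 - √2 * Real.pi * x * c * u)
      * Real.exp (m * -(-(√2 * Real.pi) * u)) / max 1 (Real.exp (-(√2 * Real.pi) * u))
      ≤ Real.exp (Real.pi / 4) * Real.exp (-(Real.pi * x / 2) * u ^ 2) := by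
    rw [div_le_iff₀ hmax, ← Real.exp_add, ← Real.exp_add]
    rcases le_total 0 u with hu | hu
    · refine le_trans ?_ (le_mul_of_one_le_right (Real.exp_pos _).le (le_max_left _ _))
      rw [Real.exp_le_exp]
      have e1 : 0 ≤ √2 * Real.pi * u * (x * c - m) :=
        mul_nonneg (by positivity) (by linarith)
      have e2 : 0 ≤ Real.pi * x * u ^ 2 := by positivity
      linarith
    · refine le_trans ?_ (mul_le_mul_of_nonneg_left (le_max_right _ _) (Real.exp_pos _).le)
      rw [← Real.exp_add, Real.exp_le_exp]
      have e1 : 0 ≤ √2 * Real.pi * (-u) * (m + 1 + x / 2 - x * c) :=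
        mul_nonneg (mul_nonneg (by positivity) (by linarith)) (by linarith)
      have h2 : √2 * √2 = 2 := Real.mul_self_sqrt (by norm_num)
      have e2 : 0 ≤ Real.pi * x / 2 * (u + √2 / 2) ^ 2 := by positivity
      have e3 : Real.pi * x / 2 * (u + √2 / 2) ^ 2
          = Real.pi * x / 2 * u ^ 2 + Real.pi * x * √2 / 2 * u + Real.pi * x / 4 := by
        linear_combination (Real.pi * x / 8) * h2
      have e4 : Real.pi * x / 4 ≤ Real.pi / 4 := by nlinarith
      linarith
  have hA : 0 ≤ Real.exp (-(Real.pi * x) * u ^ 2 - √2 * Real.pi * x * c * u)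
      * Real.exp (m * -(-(√2 * Real.pi) * u)) := by positivity
  have hNi : 0 ≤ (‖(c : ℂ) + rho * u‖ ^ s)⁻¹ := (inv_pos.mpr hN).le
  calc _ = (Real.exp (-(Real.pi * x) * u ^ 2 - √2 * Real.pi * x * c * u)
      * Real.exp (m * -(-(√2 * Real.pi) * u))) / ‖den ((c : ℂ) + rho * u)‖
        * (‖(c : ℂ) + rho * u‖ ^ s)⁻¹ := by ring
    _ ≤ (Real.exp (-(Real.pi * x) * u ^ 2 - √2 * Real.pi * x * c * u)
      * Real.exp (m * -(-(√2 * Real.pi) * u))) / (max 1 (Real.exp (-(√2 * Real.pi) * u)) / 2)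
        * (‖(c : ℂ) + rho * u‖ ^ s)⁻¹ := by
      refine mul_le_mul_of_nonneg_right ?_ hNi
      exact div_le_div_of_nonneg_left hA (by positivity) hden
    _ = 2 * ((Real.exp (-(Real.pi * x) * u ^ 2 - √2 * Real.pi * x * c * u)
      * Real.exp (m * -(-(√2 * Real.pi) * u))) / max 1 (Real.exp (-(√2 * Real.pi) * u)))
        * (‖(c : ℂ) + rho * u‖ ^ s)⁻¹ := by field_simp
    _ ≤ 2 * (Real.exp (Real.pi / 4) * Real.exp (-(Real.pi * x / 2) * u ^ 2))
        * (‖(c : ℂ) + rho * u‖ ^ s)⁻¹ := by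
      refine mul_le_mul_of_nonneg_right ?_ hNi
      linarith
    _ = _ := by ring

lemma integral_half_gaussian {x : ℝ} (hx : 0 < x) :
    ∫ u : ℝ, Real.exp (-(Real.pi * x / 2) * u ^ 2) = √2 * x ^ (-(1 / 2) : ℝ) := by
  rw [integral_gaussian]
  have : Real.pi / (Real.pi * x / 2) = 2 * x⁻¹ := by field_simp
  rw [this, Real.sqrt_mul (by norm_num), Real.sqrt_inv, Real.sqrt_eq_rpow x, Real.rpow_neg hx.le]

lemma integrable_half_gaussian {x : ℝ} (hx : 0 < x) :
    Integrable (fun u : ℝ => Real.exp (-(Real.pi * x / 2) * u ^ 2)) :=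
  integrable_exp_neg_mul_sq (by positivity)

/-- The Gaussian has mass of order x^{-1/2} and |z| ≥ n/2 on the line. The bound tends to 0 for
fixed x when s > 0, and is O(Y^{1-s}) once n ≥ Y = x^{-1/2}. -/
lemma norm_integral_remainder_le {s x : ℝ} (hs0 : 0 ≤ s) (hs1 : s ≤ 1) (hx : 0 < x) (hx1 : x ≤ 1)
    {n m : ℕ} (hn : 0 < n) (h0 : (m : ℝ) ≤ x * (n + 1 / 2))
    (h1 : x * (n + 1 / 2) ≤ m + 1 + x / 2) :
    ‖∫ u : ℝ, remainder s x n m u‖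
      ≤ 8 * Real.exp (Real.pi / 4) * x ^ (-(1 / 2) : ℝ) * (n : ℝ) ^ (-s) := by
  have hn' : (0 : ℝ) < n := by exact_mod_cast hn
  have hb : ∀ u, ‖remainder s x n m u‖ ≤ 4 * Real.exp (Real.pi / 4) * (n : ℝ) ^ (-s)
      * Real.exp (-(Real.pi * x / 2) * u ^ 2) := by
    intro u
    have e1 : (‖((n + 1 / 2 : ℝ) : ℂ) + rho * u‖ ^ s)⁻¹ ≤ 2 * (n : ℝ) ^ (-s) := by
      have e2 : (n : ℝ) / 2 ≤ ‖((n + 1 / 2 : ℝ) : ℂ) + rho * u‖ := by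
        refine le_trans ?_ (le_norm_line_left _ _)
        rw [abs_of_pos (by positivity)]
        have := sqrt_two_le_two
        gcongr; linarith
      have e3 : ((n : ℝ) / 2) ^ s ≤ ‖((n + 1 / 2 : ℝ) : ℂ) + rho * u‖ ^ s :=
        Real.rpow_le_rpow (by positivity) e2 hs0
      have e4 : (2 : ℝ) ^ s ≤ 2 := by
        simpa using Real.rpow_le_rpow_of_exponent_le (x := 2) (by norm_num) hs1
      calc _ ≤ (((n : ℝ) / 2) ^ s)⁻¹ := inv_anti₀ (by positivity) e3
        _ = 2 ^ s * (n : ℝ) ^ (-s) := by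
          rw [Real.div_rpow hn'.le (by norm_num), inv_div, Real.rpow_neg hn'.le]; ring
        _ ≤ _ := by gcongr
    refine (norm_remainder_le hx hx1 h0 h1 u).trans ?_
    calc _ ≤ 2 * Real.exp (Real.pi / 4) * Real.exp (-(Real.pi * x / 2) * u ^ 2)
          * (2 * (n : ℝ) ^ (-s)) := by gcongr
      _ = _ := by ring
  refine (norm_integral_le_of_norm_le ((integrable_half_gaussian hx).const_mul _)
    (Eventually.of_forall hb)).trans ?_
  rw [integral_const_mul, integral_half_gaussian hx]
  have := sqrt_two_le_two
  calc _ = 4 * Real.exp (Real.pi / 4) * (n : ℝ) ^ (-s) * x ^ (-(1 / 2) : ℝ) * √2 := by ring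
    _ ≤ 4 * Real.exp (Real.pi / 4) * (n : ℝ) ^ (-s) * x ^ (-(1 / 2) : ℝ) * 2 := by gcongr
    _ = _ := by ring

/-! ### Bounds uniform in x -/

/-- The size `1 + ∫_1^Y v^{-s} dv` of the partial sum `∑_{k ≤ Y} k^{-s}`. -/
noncomputable def sizeBound (s Y : ℝ) : ℝ := 1 + ∫ v in (1 : ℝ)..Y, v ^ (-s)

lemma rpow_intervalIntegrable {a b : ℝ} (ha : 0 < a) (hb : 0 < b) (s : ℝ) :
    IntervalIntegrable (fun v : ℝ => v ^ (-s)) volume a b := by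
  apply ContinuousOn.intervalIntegrable
  intro v hv
  have : 0 < v := lt_of_lt_of_le (lt_min ha hb) hv.1
  exact (Real.continuousAt_rpow_const _ _ (Or.inl this.ne')).continuousWithinAt

lemma one_le_sizeBound {s Y : ℝ} (hY : 1 ≤ Y) : 1 ≤ sizeBound s Y := by
  unfold sizeBound
  have : 0 ≤ ∫ v in (1 : ℝ)..Y, v ^ (-s) :=
    intervalIntegral.integral_nonneg hY fun v hv => Real.rpow_nonneg (by linarith [hv.1]) _
  linarith

lemma sizeBound_of_lt_one {s : ℝ} (hs : s < 1) (Y : ℝ) :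
    sizeBound s Y = 1 + (Y ^ (1 - s) - 1) / (1 - s) := by
  unfold sizeBound
  rw [integral_rpow (Or.inl (by linarith)), Real.one_rpow]
  ring_nf

lemma sizeBound_one {Y : ℝ} (hY : 1 ≤ Y) : sizeBound 1 Y = 1 + Real.log Y := by
  unfold sizeBound
  simp only [Real.rpow_neg_one]
  rw [integral_inv_of_pos one_pos (by linarith), div_one]

lemma rpow_le_sizeBound {s Y : ℝ} (hs0 : 0 ≤ s) (hs1 : s ≤ 1) (hY : 1 ≤ Y) :
    Y ^ (1 - s) ≤ sizeBound s Y := by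
  rcases hs1.lt_or_eq with h | h
  · rw [sizeBound_of_lt_one h]
    have h1 : 0 ≤ Y ^ (1 - s) - 1 := sub_nonneg.mpr (Real.one_le_rpow hY (by linarith))
    have := le_div_self h1 (by linarith : 0 < 1 - s) (by linarith)
    linarith
  · rw [h, sub_self, Real.rpow_zero]
    exact one_le_sizeBound hY

lemma sum_rpow_neg_le_sizeBound {s Y : ℝ} (hs0 : 0 ≤ s) (hY : 1 ≤ Y) {n : ℕ} (hn : (n : ℝ) ≤ Y) :
    ∑ k ∈ Finset.range n, ((k + 1 : ℕ) : ℝ) ^ (-s) ≤ sizeBound s Y := by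
  rcases n with _ | n
  · simpa using zero_le_one.trans (one_le_sizeBound hY)
  rw [Finset.sum_range_succ']
  have h := AntitoneOn.sum_le_integral (x₀ := 1) (a := n) (f := fun v : ℝ => v ^ (-s)) (by
    intro a ha b hb hab
    exact Real.rpow_le_rpow_of_nonpos (by linarith [ha.1]) hab (by linarith))
  have h2 : ∫ v in (1 : ℝ)..(1 + n), v ^ (-s) ≤ ∫ v in (1 : ℝ)..Y, v ^ (-s) := by
    push_cast at hn
    refine intervalIntegral.integral_mono_interval le_rfl (by linarith [Nat.cast_nonneg (α := ℝ) n])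
      (by linarith) ?_ (rpow_intervalIntegrable one_pos (by linarith) s)
    refine (ae_restrict_iff' measurableSet_Ioc).mpr (Eventually.of_forall fun v hv => ?_)
    exact Real.rpow_nonneg (by linarith [hv.1]) _
  unfold sizeBound
  have h3 : ∑ k ∈ Finset.range n, ((k + 1 + 1 : ℕ) : ℝ) ^ (-s)
      = ∑ i ∈ Finset.range n, (1 + ((i + 1 : ℕ) : ℝ)) ^ (-s) := by
    refine Finset.sum_congr rfl fun k _ => ?_
    congr 1; push_cast; ring
  rw [h3]
  have h4 : (((0 + 1 : ℕ)) : ℝ) ^ (-s) = 1 := by simp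
  rw [h4]
  linarith

/-- Split at |u| = Y, the width of the Gaussian. Below Y, dropping the Gaussian leaves exactly
`sizeBound`; above, |u|^{-s} ≤ Y^{-s} against total mass √2·Y gives √2·Y^{1-s}. Doubling by
evenness, 2(1 + √2) ≤ 6. -/
lemma integral_gaussian_mul_max_le {s x Y : ℝ} (hs0 : 0 ≤ s) (hs1 : s ≤ 1) (hx : 0 < x)
    (hY : Y = x ^ (-(1 / 2) : ℝ)) (hY1 : 1 ≤ Y) :
    Integrable (fun u : ℝ => Real.exp (-(Real.pi * x / 2) * u ^ 2) * max 1 |u| ^ (-s)) ∧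
    ∫ u : ℝ, Real.exp (-(Real.pi * x / 2) * u ^ 2) * max 1 |u| ^ (-s) ≤ 6 * sizeBound s Y := by
  set f : ℝ → ℝ := fun v => Real.exp (-(Real.pi * x / 2) * v ^ 2) * max 1 v ^ (-s) with hf
  have hmax : ∀ v : ℝ, 0 < max 1 v := fun v => lt_max_of_lt_left one_pos
  have hmc : Continuous (fun v : ℝ => max 1 v ^ (-s)) :=
    (continuous_const.max continuous_id).rpow_const fun v => Or.inl (hmax v).ne'
  have hm1 : ∀ v : ℝ, max 1 v ^ (-s) ≤ 1 := fun v =>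
    Real.rpow_le_one_of_one_le_of_nonpos (le_max_left _ _) (by linarith)
  have hfc : Continuous f := Continuous.mul (by fun_prop) hmc
  have hG := integrable_half_gaussian hx
  have hfi : Integrable f := by
    refine hG.mono' hfc.aestronglyMeasurable (Eventually.of_forall fun v => ?_)
    rw [Real.norm_of_nonneg (mul_nonneg (Real.exp_pos _).le (Real.rpow_nonneg (hmax v).le _))]
    exact mul_le_of_le_one_right (Real.exp_pos _).le (hm1 v)
  have hfa : (fun u : ℝ => Real.exp (-(Real.pi * x / 2) * u ^ 2) * max 1 |u| ^ (-s))
      = fun u => f |u| := by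
    ext u; simp [hf, sq_abs]
  refine ⟨?_, ?_⟩
  · rw [hfa]
    refine hG.mono' (hfc.comp continuous_abs).aestronglyMeasurable (Eventually.of_forall fun v => ?_)
    rw [Real.norm_of_nonneg (mul_nonneg (Real.exp_pos _).le (Real.rpow_nonneg (hmax _).le _))]
    have := mul_le_of_le_one_right (Real.exp_pos (-(Real.pi * x / 2) * |v| ^ 2)).le (hm1 |v|)
    rwa [sq_abs] at this ⊢
  rw [hfa, integral_comp_abs]
  have hY0 : 0 ≤ Y := by linarith
  rw [← Set.Ioc_union_Ioi_eq_Ioi hY0, setIntegral_union Set.Ioc_disjoint_Ioi_same measurableSet_Ioi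
    hfi.integrableOn hfi.integrableOn]
  have b1 : ∫ v in Set.Ioc 0 Y, f v ≤ sizeBound s Y := by
    have e1 : ∫ v in Set.Ioc 0 Y, f v ≤ ∫ v in Set.Ioc 0 Y, max 1 v ^ (-s) := by
      refine setIntegral_mono_on hfi.integrableOn (hmc.integrableOn_Ioc) measurableSet_Ioc ?_
      intro v _
      refine mul_le_of_le_one_left (Real.rpow_nonneg (hmax v).le _) ?_
      rw [Real.exp_le_one_iff]
      have : 0 ≤ Real.pi * x / 2 * v ^ 2 := by positivity
      linarith
    refine e1.trans (le_of_eq ?_)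
    rw [← intervalIntegral.integral_of_le hY0,
      ← intervalIntegral.integral_add_adjacent_intervals (b := 1) (hmc.intervalIntegrable _ _)
        (hmc.intervalIntegrable _ _)]
    unfold sizeBound
    congr 1
    · rw [intervalIntegral.integral_congr (g := fun _ => (1 : ℝ))]
      · simp
      · intro v hv
        rw [Set.uIcc_of_le zero_le_one] at hv
        simp [max_eq_left hv.2]
    · refine intervalIntegral.integral_congr fun v hv => ?_
      rw [Set.uIcc_of_le hY1] at hv
      simp only [max_eq_right hv.1]
  have b2 : ∫ v in Set.Ioi Y, f v ≤ √2 * sizeBound s Y := by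
    have e1 : ∫ v in Set.Ioi Y, f v
        ≤ ∫ v in Set.Ioi Y, Y ^ (-s) * Real.exp (-(Real.pi * x / 2) * v ^ 2) := by
      refine setIntegral_mono_on hfi.integrableOn (hG.const_mul _).integrableOn measurableSet_Ioi ?_
      intro v hv
      rw [mul_comm (Y ^ (-s))]
      refine mul_le_mul_of_nonneg_left ?_ (Real.exp_pos _).le
      exact Real.rpow_le_rpow_of_nonpos (by linarith) ((le_of_lt hv).trans (le_max_right _ _))
        (by linarith)
    have e2 : ∫ v in Set.Ioi Y, Y ^ (-s) * Real.exp (-(Real.pi * x / 2) * v ^ 2)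
        ≤ ∫ v, Y ^ (-s) * Real.exp (-(Real.pi * x / 2) * v ^ 2) :=
      setIntegral_le_integral (hG.const_mul _) (Eventually.of_forall fun v => by
        have : 0 ≤ Y ^ (-s) := Real.rpow_nonneg hY0 _
        positivity)
    refine (e1.trans e2).trans ?_
    rw [integral_const_mul, integral_half_gaussian hx, ← hY]
    have e3 : Y ^ (-s) * (√2 * Y) = √2 * Y ^ (1 - s) := by
      rw [sub_eq_neg_add, Real.rpow_add (by linarith), Real.rpow_one]; ring
    rw [e3]
    exact mul_le_mul_of_nonneg_left (rpow_le_sizeBound hs0 hs1 hY1) (Real.sqrt_nonneg 2)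
  have := sqrt_two_le_two
  have hW := one_le_sizeBound (s := s) hY1
  nlinarith

/-- With n = m = 0 the remainder is the integrand of the contour integral in I_s. On that line |z| ≥
max(1, |u|)/4, whence 48 = 2·4·6. -/
lemma norm_integral_remainder_zero_le {s x Y : ℝ} (hs0 : 0 ≤ s) (hs1 : s ≤ 1) (hx : 0 < x)
    (hx1 : x ≤ 1) (hY : Y = x ^ (-(1 / 2) : ℝ)) (hY1 : 1 ≤ Y) :
    ‖∫ u : ℝ, remainder s x 0 0 u‖ ≤ 48 * Real.exp (Real.pi / 4) * sizeBound s Y := by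
  obtain ⟨hi, hle⟩ := integral_gaussian_mul_max_le hs0 hs1 hx hY hY1
  have hb : ∀ u, ‖remainder s x 0 0 u‖ ≤ 8 * Real.exp (Real.pi / 4) *
      (Real.exp (-(Real.pi * x / 2) * u ^ 2) * max 1 |u| ^ (-s)) := by
    intro u
    have hm : 0 < max 1 |u| := lt_max_of_lt_left one_pos
    have e1 : (‖(((0 : ℕ) + 1 / 2 : ℝ) : ℂ) + rho * u‖ ^ s)⁻¹ ≤ 4 * max 1 |u| ^ (-s) := by
      have h12 := sqrt_two_le_two
      have e2 : max 1 |u| / 4 ≤ ‖(((0 : ℕ) + 1 / 2 : ℝ) : ℂ) + rho * u‖ := by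
        rw [div_le_iff₀ (by norm_num)]
        apply max_le
        · have := le_norm_line_left ((0 : ℕ) + 1 / 2 : ℝ) u
          have h3 : (1 : ℝ) / 4 ≤ |((0 : ℕ) + 1 / 2 : ℝ)| / √2 := by
            rw [le_div_iff₀ (by positivity)]; norm_num; linarith
          linarith
        · have := le_norm_line_right ((0 : ℕ) + 1 / 2 : ℝ) u
          have h3 : |u| / 4 ≤ |u| / √2 := by gcongr; linarith
          linarith
      have e3 := Real.rpow_le_rpow (by positivity) e2 hs0
      have e4 : (4 : ℝ) ^ s ≤ 4 := by
        simpa using Real.rpow_le_rpow_of_exponent_le (x := 4) (by norm_num) hs1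
      calc _ ≤ ((max 1 |u| / 4) ^ s)⁻¹ := inv_anti₀ (by positivity) e3
        _ = 4 ^ s * max 1 |u| ^ (-s) := by
          rw [Real.div_rpow hm.le (by norm_num), inv_div, Real.rpow_neg hm.le]; ring
        _ ≤ _ := by gcongr
    refine (norm_remainder_le hx hx1 (by push_cast; positivity) (by push_cast; linarith) u).trans ?_
    calc _ ≤ 2 * Real.exp (Real.pi / 4) * Real.exp (-(Real.pi * x / 2) * u ^ 2)
          * (4 * max 1 |u| ^ (-s)) := by gcongr
      _ = _ := by ring
  refine (norm_integral_le_of_norm_le (hi.const_mul _) (Eventually.of_forall hb)).trans ?_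
  rw [integral_const_mul]
  have : 0 < Real.exp (Real.pi / 4) := Real.exp_pos _
  nlinarith

lemma summable_inner {s : ℝ} (hs : 0 < s) :
    Summable (fun k : ℕ => 1 / ((k + 1 : ℕ) : ℝ) ^ (s + 1)) :=
  (summable_nat_add_iff 1).mpr (Real.summable_one_div_nat_rpow.mpr (by linarith))

lemma norm_gaussian_mul_sum_le {s x : ℝ} (hs0 : 0 < s) (hs1 : s ≤ 1) (hx : 0 < x) (m : ℕ) (u : ℝ) :
    ‖Complex.exp (-Real.pi * x * (u : ℂ) ^ 2) * ∑ k ∈ Finset.range m, innerTerm s x k u‖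
      ≤ 2 * x * (∑' k : ℕ, 1 / ((k + 1 : ℕ) : ℝ) ^ (s + 1))
        * (|u| * Real.exp (-(Real.pi * x) * u ^ 2)) := by
  rw [norm_mul, norm_cexp_gaussian]
  have h1 : ‖∑ k ∈ Finset.range m, innerTerm s x k u‖
      ≤ 2 * x * |u| * ∑' k : ℕ, 1 / ((k + 1 : ℕ) : ℝ) ^ (s + 1) := by
    refine (norm_sum_le _ _).trans ?_
    refine (Finset.sum_le_sum fun k _ => norm_innerTerm_le hs0.le hs1 hx k u).trans ?_
    rw [← Finset.mul_sum]
    refine mul_le_mul_of_nonneg_left ?_ (by positivity)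
    exact (summable_inner hs0).sum_le_tsum _ (fun k _ => by positivity)
  refine (mul_le_mul_of_nonneg_left h1 (Real.exp_pos _).le).trans (le_of_eq (by ring))

lemma integral_abs_mul_gaussian_le {x : ℝ} (hx : 0 < x) :
    ∫ u : ℝ, |u| * Real.exp (-(Real.pi * x) * u ^ 2) ≤ 2 * x⁻¹ := by
  have hb : ∀ u : ℝ, |u| * Real.exp (-(Real.pi * x) * u ^ 2)
      ≤ x ^ (-(1 / 2) : ℝ) * Real.exp (-(Real.pi * x / 2) * u ^ 2) := by
    intro u
    have e0 : -(Real.pi * x) * u ^ 2 = -(Real.pi * x / 2) * u ^ 2 + -(Real.pi * x / 2) * u ^ 2 := by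
      ring
    rw [e0, Real.exp_add, ← mul_assoc]
    refine mul_le_mul_of_nonneg_right ?_ (Real.exp_pos _).le
    have hsx : 0 < √x := Real.sqrt_pos.mpr hx
    have hsq : √x ^ 2 = x := Real.sq_sqrt hx.le
    rw [Real.rpow_neg hx.le, ← Real.sqrt_eq_rpow, neg_mul, Real.exp_neg, ← div_eq_mul_inv,
      div_le_iff₀ (Real.exp_pos _), inv_mul_eq_div, le_div_iff₀ hsx]
    have e1 := Real.add_one_le_exp (Real.pi * x / 2 * u ^ 2)
    have e2 : (|u| * √x) ^ 2 = x * u ^ 2 := by rw [mul_pow, hsq, sq_abs]; ring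
    have hpi := Real.pi_gt_three
    have e3 : 0 ≤ x * u ^ 2 := by positivity
    nlinarith [sq_nonneg (|u| * √x - 1)]
  refine (integral_mono (integrable_abs_mul_gaussian hx)
    ((integrable_half_gaussian hx).const_mul _) hb).trans ?_
  rw [integral_const_mul, integral_half_gaussian hx]
  have e : x ^ (-(1 / 2) : ℝ) * x ^ (-(1 / 2) : ℝ) = x⁻¹ := by
    rw [← Real.rpow_add hx, ← Real.rpow_neg_one]; norm_num
  calc _ = √2 * (x ^ (-(1 / 2) : ℝ) * x ^ (-(1 / 2) : ℝ)) := by ring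
    _ ≤ 2 * x⁻¹ := by
      rw [e]; exact mul_le_mul_of_nonneg_right sqrt_two_le_two (by positivity)

/-- The factor x of the mean value estimate cancels the 1/x of the first absolute Gaussian moment,
so the bound is uniform in x and m. -/
lemma norm_integral_gaussian_mul_sum_le {s x : ℝ} (hs0 : 0 < s) (hs1 : s ≤ 1) (hx : 0 < x)
    (m : ℕ) :
    ‖∫ u : ℝ, Complex.exp (-Real.pi * x * (u : ℂ) ^ 2) * ∑ k ∈ Finset.range m, innerTerm s x k u‖
      ≤ 4 * ∑' k : ℕ, 1 / ((k + 1 : ℕ) : ℝ) ^ (s + 1) := by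
  refine (norm_integral_le_of_norm_le ((integrable_abs_mul_gaussian hx).const_mul _)
    (Eventually.of_forall (norm_gaussian_mul_sum_le hs0 hs1 hx m))).trans ?_
  rw [integral_const_mul]
  have hZ : 0 ≤ ∑' k : ℕ, 1 / ((k + 1 : ℕ) : ℝ) ^ (s + 1) := tsum_nonneg fun k => by positivity
  calc _ ≤ 2 * x * (∑' k : ℕ, 1 / ((k + 1 : ℕ) : ℝ) ^ (s + 1)) * (2 * x⁻¹) :=
        mul_le_mul_of_nonneg_left (integral_abs_mul_gaussian_le hx) (by positivity)
    _ = _ := by field_simp; ring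

lemma tendsto_integral_gaussian_mul_sum {s x : ℝ} (hs0 : 0 < s) (hs1 : s ≤ 1) (hx : 0 < x) :
    Tendsto (fun m : ℕ => ∫ u : ℝ, Complex.exp (-Real.pi * x * (u : ℂ) ^ 2)
        * ∑ k ∈ Finset.range m, innerTerm s x k u) atTop
      (𝓝 (∫ u : ℝ, Complex.exp (-Real.pi * x * (u : ℂ) ^ 2) * innerSeries s x 0 u)) := by
  refine tendsto_integral_of_dominated_convergence _ (fun m => ?_)
    ((integrable_abs_mul_gaussian hx).const_mul _)
    (fun m => Eventually.of_forall (norm_gaussian_mul_sum_le hs0 hs1 hx m))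
    (Eventually.of_forall fun u => ?_)
  · exact Continuous.aestronglyMeasurable (Continuous.mul (by fun_prop)
      (continuous_finsetSum _ fun k _ => continuous_innerTerm s x k))
  · rw [innerSeries_zero]
    refine Tendsto.const_mul _ (Summable.hasSum ?_).tendsto_sum_nat
    exact Summable.of_norm_bounded ((summable_inner hs0).mul_left _)
      (fun k => norm_innerTerm_le hs0.le hs1 hx k u)

lemma transformation_remainder {s x : ℝ} (hs0 : 0 ≤ s) (hs1 : s ≤ 1) (hx : 0 < x) (n m : ℕ) :
    partialF s n x 0 - rho * ((x ^ (s - 1 / 2) : ℝ) : ℂ) * partialF s m (-1 / x) 0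
      = rho * (∫ u : ℝ, remainder s x 0 0 u)
        + rho * ((x ^ s : ℝ) : ℂ) * (∫ u : ℝ, Complex.exp (-Real.pi * x * (u : ℂ) ^ 2)
            * ∑ k ∈ Finset.range m, innerTerm s x k u)
        - rho * ∫ u : ℝ, remainder s x n m u := by
  rw [partialF_sub_partialF hs0 hs1 hx]
  simp [remainder]

/-! ### The approximate functional equation -/

/-- The choice m = ⌊nx⌋ meets the conditions of `norm_remainder_le`; the slack x/2 comes from the
line passing through n + 1/2 instead of n. -/
lemma floor_bounds {x : ℝ} (hx : 0 < x) (n : ℕ) :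
    ((⌊n * x⌋₊ : ℕ) : ℝ) ≤ x * (n + 1 / 2) ∧ x * (n + 1 / 2) ≤ (⌊n * x⌋₊ : ℕ) + 1 + x / 2 := by
  have h1 := Nat.floor_le (a := n * x) (by positivity)
  have h2 := Nat.lt_floor_add_one (n * x)
  constructor <;> nlinarith

/-- In the exact formula the integral on the far line vanishes as n → ∞ and the correction sum
converges by domination; what is left is I_s. -/
theorem tendsto_partialF_sub_partialF {s x : ℝ} (hs0 : 0 < s) (hs1 : s ≤ 1) (hx : 0 < x)
    (hx1 : x ≤ 1) :
    Tendsto (fun n : ℕ => partialF s n x 0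
        - rho * ((x ^ (s - 1 / 2) : ℝ) : ℂ) * partialF s ⌊n * x⌋₊ (-1 / x) 0)
      atTop (𝓝 (fnI s x 0)) := by
  simp only [transformation_remainder hs0.le hs1 hx]
  have hm : Tendsto (fun n : ℕ => ⌊n * x⌋₊) atTop atTop :=
    tendsto_nat_floor_atTop.comp (tendsto_natCast_atTop_atTop.atTop_mul_const hx)
  have t1 := ((tendsto_integral_gaussian_mul_sum hs0 hs1 hx).comp hm).const_mul
    (rho * ((x ^ s : ℝ) : ℂ))
  have t2 : Tendsto (fun n : ℕ => ∫ u : ℝ, remainder s x n ⌊n * x⌋₊ u) atTop (𝓝 0) := by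
    have h0 : Tendsto (fun n : ℕ => 8 * Real.exp (Real.pi / 4) * x ^ (-(1 / 2) : ℝ)
        * (n : ℝ) ^ (-s)) atTop (𝓝 0) := by
      simpa using ((tendsto_rpow_neg_atTop hs0).comp tendsto_natCast_atTop_atTop).const_mul
        (8 * Real.exp (Real.pi / 4) * x ^ (-(1 / 2) : ℝ))
    refine squeeze_zero_norm' ?_ h0
    filter_upwards [eventually_gt_atTop 0] with n hn
    obtain ⟨h1, h2⟩ := floor_bounds hx n
    exact norm_integral_remainder_le hs0.le hs1 hx hx1 hn h1 h2
  have e : fnI s x 0 = rho * (∫ u : ℝ, remainder s x 0 0 u)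
        + rho * ((x ^ s : ℝ) : ℂ) * (∫ u : ℝ, Complex.exp (-Real.pi * x * (u : ℂ) ^ 2)
            * innerSeries s x 0 u) - rho * 0 := by
    unfold fnI
    rw [mul_zero, sub_zero, integral_mul_const]
    simp [contourIntegrand_zero, remainder, mul_comm rho]
  rw [e]
  exact (t1.const_add _).sub (t2.const_mul rho)

/-- A uniform bound for the defect in the approximate functional equation. -/
theorem exists_norm_partialF_sub_le {s : ℝ} (hs0 : 0 < s) (hs1 : s ≤ 1) :
    ∃ C : ℝ, 0 ≤ C ∧ ∀ x : ℝ, 0 < x → x ≤ 1 → ∀ n : ℕ,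
      ‖partialF s n x 0 - rho * ((x ^ (s - 1 / 2) : ℝ) : ℂ) * partialF s ⌊n * x⌋₊ (-1 / x) 0‖
        ≤ C * sizeBound s (x ^ (-(1 / 2) : ℝ)) := by
  set Z := ∑' k : ℕ, 1 / ((k + 1 : ℕ) : ℝ) ^ (s + 1) with hZ
  have hZ0 : 0 ≤ Z := tsum_nonneg fun k => by positivity
  set E := Real.exp (Real.pi / 4) with hE
  have hE1 : 1 ≤ E := Real.one_le_exp (by positivity)
  -- 56 = 48 + 8 collects the lines through 1/2 and n + 1/2; 4Z comes from the saddle corrections.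
  refine ⟨56 * E + 4 * Z, by positivity, fun x hx hx1 n => ?_⟩
  set Y := x ^ (-(1 / 2) : ℝ) with hY
  have hY1 : 1 ≤ Y := Real.one_le_rpow_of_pos_of_le_one_of_nonpos hx hx1 (by norm_num)
  have hW := one_le_sizeBound (s := s) hY1
  -- If n < Y then nx < √x ≤ 1, so the dual sum is empty and the trivial bound on the partial sum
  -- suffices. If n ≥ Y the remainder estimate is strong enough.
  rcases lt_or_ge (n : ℝ) Y with hn | hn
  · have hfl : ⌊n * x⌋₊ = 0 := by
      rw [Nat.floor_eq_zero]
      have e1 : Y * x = x ^ (1 / 2 : ℝ) := by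
        calc Y * x = x ^ (-(1 / 2) : ℝ) * x ^ (1 : ℝ) := by rw [Real.rpow_one]
          _ = x ^ (1 / 2 : ℝ) := by rw [← Real.rpow_add hx]; norm_num
      have e2 : x ^ (1 / 2 : ℝ) ≤ 1 := Real.rpow_le_one hx.le hx1 (by norm_num)
      nlinarith
    have h0 : partialF s 0 (-1 / x) 0 = 0 := by simp [partialF]
    rw [hfl, h0, mul_zero, sub_zero, partialF_zero]
    have h1 : ‖∑ k ∈ Finset.range n, chirp s x ((k + 1 : ℕ) : ℂ)‖ ≤ sizeBound s Y := by
      refine (norm_sum_le _ _).trans (le_trans (le_of_eq ?_)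
        (sum_rpow_neg_le_sizeBound hs0.le hY1 hn.le))
      refine Finset.sum_congr rfl fun k _ => ?_
      have := norm_chirp_line s x ((k + 1 : ℕ) : ℝ) 0
      simp only [Complex.ofReal_zero, mul_zero, add_zero] at this
      rw [Complex.ofReal_natCast] at this
      rw [this, Complex.norm_natCast, Real.rpow_neg (by positivity)]
      simp
    nlinarith
  · have hn0 : 0 < n := by
      have : (0 : ℝ) < n := by linarith
      exact_mod_cast this
    have hn0' : (0 : ℝ) < n := by exact_mod_cast hn0
    obtain ⟨h1, h2⟩ := floor_bounds hx n
    have b1 := norm_integral_remainder_le hs0.le hs1 hx hx1 hn0 h1 h2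
    have b2 := norm_integral_gaussian_mul_sum_le hs0 hs1 hx ⌊n * x⌋₊
    have b3 := norm_integral_remainder_zero_le hs0.le hs1 hx hx1 hY hY1
    rw [transformation_remainder hs0.le hs1 hx]
    have hxs : x ^ s ≤ 1 := Real.rpow_le_one hx.le hx1 hs0.le
    have hxs0 : 0 ≤ x ^ s := Real.rpow_nonneg hx.le s
    refine (norm_sub_le _ _).trans ((add_le_add_left (norm_add_le _ _) _).trans ?_)
    rw [norm_mul, norm_mul, norm_mul, norm_mul, norm_rho, Complex.norm_real,
      Real.norm_of_nonneg hxs0, one_mul, one_mul, one_mul]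
    have b4 : 8 * E * Y * (n : ℝ) ^ (-s) ≤ 8 * E * sizeBound s Y := by
      have e1 : (n : ℝ) ^ (-s) ≤ Y ^ (-s) :=
        Real.rpow_le_rpow_of_nonpos (by linarith) hn (by linarith)
      have e2 : Y * Y ^ (-s) = Y ^ (1 - s) := by
        rw [sub_eq_add_neg, Real.rpow_add (by linarith), Real.rpow_one]
      calc 8 * E * Y * (n : ℝ) ^ (-s) ≤ 8 * E * Y * Y ^ (-s) := by gcongr
        _ = 8 * E * Y ^ (1 - s) := by rw [← e2]; ring
        _ ≤ _ := by
          have := rpow_le_sizeBound hs0.le hs1 hY1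
          gcongr
    have b5 : x ^ s * ‖∫ u : ℝ, Complex.exp (-Real.pi * x * (u : ℂ) ^ 2)
        * ∑ k ∈ Finset.range ⌊n * x⌋₊, innerTerm s x k u‖ ≤ 4 * Z :=
      (mul_le_of_le_one_left (norm_nonneg _) hxs).trans b2
    have b6 : 4 * Z ≤ 4 * Z * sizeBound s Y := le_mul_of_one_le_right (by positivity) hW
    linarith

/-! ### Symmetries of the sums and the map T -/

lemma chirp_add_two_mul (s x : ℝ) (m : ℤ) (k : ℕ) :
    chirp s (x + 2 * m) (k : ℂ) = chirp s x (k : ℂ) := by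
  unfold chirp
  have : Complex.I * Real.pi * (k : ℂ) ^ 2 * ((x + 2 * m : ℝ) : ℂ)
      = Complex.I * Real.pi * (k : ℂ) ^ 2 * x
        + ((k ^ 2 * m : ℤ) : ℂ) * (2 * Real.pi * Complex.I) := by push_cast; ring
  rw [this, Complex.exp_add, Complex.exp_int_mul_two_pi_mul_I, mul_one]

lemma chirp_neg (s x : ℝ) (k : ℕ) :
    chirp s (-x) (k : ℂ) = (starRingEnd ℂ) (chirp s x (k : ℂ)) := by
  unfold chirp
  have h : ((k : ℂ)) ^ (s : ℂ) = (((k : ℝ) ^ s : ℝ) : ℂ) := by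
    rw [Complex.ofReal_cpow (Nat.cast_nonneg k)]; simp
  rw [h, map_div₀, Complex.conj_ofReal, ← Complex.exp_conj]
  simp

lemma partialF_add_two_mul (s : ℝ) (n : ℕ) (x : ℝ) (m : ℤ) :
    partialF s n (x + 2 * m) 0 = partialF s n x 0 := by
  simp only [partialF_zero, chirp_add_two_mul]

lemma partialF_neg (s : ℝ) (n : ℕ) (x : ℝ) :
    partialF s n (-x) 0 = (starRingEnd ℂ) (partialF s n x 0) := by
  simp only [partialF_zero, chirp_neg, map_sum]

lemma exists_T_eq (y : ℝ) : ∃ m : ℤ, T y = -1 / y + 2 * m := by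
  refine ⟨-toIcoDiv (two_pos : (0 : ℝ) < 2) (-1) (-1 / y), ?_⟩
  unfold T
  rw [toIcoMod, zsmul_eq_mul]
  push_cast; ring

lemma partialF_T (s : ℝ) (n : ℕ) (y : ℝ) : partialF s n (T y) 0 = partialF s n (-1 / y) 0 := by
  obtain ⟨m, hm⟩ := exists_T_eq y
  rw [hm, partialF_add_two_mul]

lemma irrational_T {y : ℝ} (hy : Irrational y) : Irrational (T y) := by
  obtain ⟨m, hm⟩ := exists_T_eq y
  have h1 : Irrational (-1 / y) := by
    have := hy.inv.neg
    rwa [← one_div, ← neg_div] at this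
  rw [hm]
  exact_mod_cast h1.add_intCast (2 * m)

lemma T_mem_Ioo {y : ℝ} (hy : Irrational y) : T y ∈ Set.Ioo (-1 : ℝ) 1 := by
  have h := toIcoMod_mem_Ico (two_pos : (0 : ℝ) < 2) (-1) (-1 / y)
  change T y ∈ _ at h
  have h2 := h.2
  refine ⟨lt_of_le_of_ne h.1 fun h3 => ?_, by linarith⟩
  exact (irrational_T hy).ne_int (-1) (by rw [← h3]; simp)

lemma irrational_iterate_T {x : ℝ} (hx : Irrational x) (j : ℕ) : Irrational (T^[j] x) := by
  induction j with
  | zero => exact hx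
  | succ j ih => rw [Function.iterate_succ_apply']; exact irrational_T ih

lemma iterate_T_mem_Ioo {x : ℝ} (hx : x ∈ Set.Ioo (-1 : ℝ) 1) (hirr : Irrational x) (j : ℕ) :
    T^[j] x ∈ Set.Ioo (-1 : ℝ) 1 := by
  cases j with
  | zero => exact hx
  | succ j => rw [Function.iterate_succ_apply']; exact T_mem_Ioo (irrational_iterate_T hirr j)

/-! ### Iteration along the orbit of T -/

/-- The defect of the partial sums in the approximate functional equation. -/
noncomputable def defect (s : ℝ) (n : ℕ) (y : ℝ) : ℂ :=
  partialF s n y 0 - Complex.exp (Complex.I * (Real.pi / 4) * (Real.sign y : ℝ))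
    * ((|y| ^ (s - 1 / 2) : ℝ) : ℂ) * partialF s ⌊n * |y|⌋₊ (T y) 0

lemma defect_of_pos (s : ℝ) (n : ℕ) {y : ℝ} (hy : 0 < y) :
    defect s n y = partialF s n y 0
      - rho * ((y ^ (s - 1 / 2) : ℝ) : ℂ) * partialF s ⌊n * y⌋₊ (-1 / y) 0 := by
  unfold defect rho
  rw [partialF_T, Real.sign_of_pos hy, abs_of_pos hy, Complex.ofReal_one, mul_one, mul_div_assoc]

/-- Conjugation exchanges y and -y in the sums, conjugates the phase e^{±iπ/4}, and is compatible
with y ↦ -1/y, which is odd. -/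
lemma defect_of_neg (s : ℝ) (n : ℕ) {y : ℝ} (hy : y < 0) :
    defect s n y = (starRingEnd ℂ) (defect s n (-y)) := by
  rw [defect_of_pos s n (neg_pos.mpr hy)]
  unfold defect rho
  rw [partialF_T, Real.sign_of_neg hy, abs_of_neg hy, map_sub, map_mul, map_mul, ← partialF_neg,
    ← partialF_neg, Complex.conj_ofReal, ← Complex.exp_conj]
  have h1 : -(-1 / -y) = -1 / y := by rw [div_neg, neg_neg]
  rw [h1, neg_neg]
  have h4 : (starRingEnd ℂ) 4 = 4 := map_ofNat _ 4
  congr 4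
  simp [h4]
  ring

lemma tendsto_defect {s : ℝ} (hs0 : 0 < s) (hs1 : s ≤ 1) {y : ℝ} (hy : y ∈ Set.Ioo (-1 : ℝ) 1)
    (hy0 : y ≠ 0) : Tendsto (fun n : ℕ => defect s n y) atTop (𝓝 (Omega s y 0)) := by
  rcases hy0.lt_or_gt with h | h
  · simp only [defect_of_neg s _ h, Omega, not_lt.mpr h.le, h, if_true, if_false,
      defect_of_pos s _ (neg_pos.mpr h)]
    rw [neg_zero]
    exact (Complex.continuous_conj.tendsto _).comp
      (tendsto_partialF_sub_partialF hs0 hs1 (neg_pos.mpr h) (by linarith [hy.1]))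
  · simp only [defect_of_pos s _ h, Omega, h, if_true]
    exact tendsto_partialF_sub_partialF hs0 hs1 h hy.2.le

lemma exists_norm_defect_le {s : ℝ} (hs0 : 0 < s) (hs1 : s ≤ 1) :
    ∃ C : ℝ, 0 ≤ C ∧ ∀ y ∈ Set.Ioo (-1 : ℝ) 1, y ≠ 0 → ∀ n : ℕ,
      ‖defect s n y‖ ≤ C * sizeBound s (|y| ^ (-(1 / 2) : ℝ)) := by
  obtain ⟨C, hC, h⟩ := exists_norm_partialF_sub_le hs0 hs1
  refine ⟨C, hC, fun y hy hy0 n => ?_⟩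
  rcases hy0.lt_or_gt with h0 | h0
  · rw [defect_of_neg s n h0, RCLike.norm_conj, defect_of_pos s n (neg_pos.mpr h0), abs_of_neg h0]
    exact h _ (neg_pos.mpr h0) (by linarith [hy.1]) n
  · rw [defect_of_pos s n h0, abs_of_pos h0]
    exact h _ h0 hy.2.le n

/-- The lengths of the sums produced by iterating the approximate functional equation. -/
noncomputable def sumLength (x : ℝ) (n : ℕ) : ℕ → ℕ
  | 0 => n
  | j + 1 => ⌊(sumLength x n j : ℝ) * |T^[j] x|⌋₊

/-- As |T^j x| < 1, the floor loses at least one unit per step until the length is 0, so the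
iteration stops after at most n steps. -/
lemma sumLength_le {x : ℝ} (hx : x ∈ Set.Ioo (-1 : ℝ) 1) (hirr : Irrational x) (n j : ℕ) :
    sumLength x n j ≤ n - j := by
  induction j with
  | zero => exact le_rfl
  | succ j ih =>
    have hlt : |T^[j] x| < 1 := abs_lt.mpr (iterate_T_mem_Ioo hx hirr j)
    rcases Nat.eq_zero_or_pos (sumLength x n j) with h | h
    · simp [sumLength, h]
    · have : sumLength x n (j + 1) < sumLength x n j := by
        have hp : (0 : ℝ) < sumLength x n j := by exact_mod_cast h
        rw [sumLength, Nat.floor_lt (by positivity)]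
        exact mul_lt_of_lt_one_right hp hlt
      omega

lemma tendsto_sumLength {x : ℝ} (hirr : Irrational x) (j : ℕ) :
    Tendsto (fun n => sumLength x n j) atTop atTop := by
  induction j with
  | zero => exact tendsto_id
  | succ j ih =>
    exact tendsto_nat_floor_atTop.comp ((tendsto_natCast_atTop_atTop.comp ih).atTop_mul_const
      (abs_pos.mpr (irrational_iterate_T hirr j).ne_zero))

lemma phase_succ (x : ℝ) (j : ℕ) :
    phase x (j + 1) = phase x j
      * Complex.exp (Complex.I * (Real.pi / 4) * (Real.sign (T^[j] x) : ℝ)) := by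
  unfold phase
  rw [Finset.sum_range_succ, ← Complex.exp_add]
  congr 1; push_cast; ring

lemma norm_phase (x : ℝ) (j : ℕ) : ‖phase x j‖ = 1 := by
  unfold phase
  rw [mul_comm Complex.I, mul_right_comm]
  have : ((Real.pi : ℂ) / 4) * ((∑ l ∈ Finset.range j, Real.sign (T^[l] x) : ℝ) : ℂ)
      = ((Real.pi / 4 * ∑ l ∈ Finset.range j, Real.sign (T^[l] x) : ℝ) : ℂ) := by push_cast; ring
  rw [this, Complex.norm_exp_ofReal_mul_I]

lemma absProd_nonneg (x : ℝ) (j : ℕ) : 0 ≤ absProd x j := abs_nonneg _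

lemma absProd_succ (x : ℝ) (j : ℕ) : absProd x (j + 1) = absProd x j * |T^[j] x| := by
  unfold absProd
  rw [Finset.prod_range_succ, abs_mul]

/-- Iterating the approximate functional equation. -/
lemma partialF_eq_sum_defect (s x : ℝ) (n J : ℕ) :
    partialF s n x 0
      = (∑ j ∈ Finset.range J, phase x j * ((absProd x j ^ (s - 1 / 2) : ℝ) : ℂ)
          * defect s (sumLength x n j) (T^[j] x))
        + phase x J * ((absProd x J ^ (s - 1 / 2) : ℝ) : ℂ)
          * partialF s (sumLength x n J) (T^[J] x) 0 := by
  induction J with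
  | zero => simp [phase, absProd, sumLength]
  | succ J ih =>
    rw [Finset.sum_range_succ, phase_succ, absProd_succ,
      Real.mul_rpow (absProd_nonneg x J) (abs_nonneg _), Function.iterate_succ_apply', sumLength]
    conv_lhs => rw [ih]
    unfold defect
    push_cast
    ring

lemma defect_zero_length (s y : ℝ) : defect s 0 y = 0 := by
  simp [defect, partialF]

/-- Convergence of the series under summability of the uniform majorant of the defects. -/
theorem exists_tendsto_of_summable_sizeBound {x : ℝ} (hx : x ∈ Set.Ioo (-1 : ℝ) 1)
    (hirr : Irrational x) {s : ℝ} (hs0 : 0 < s) (hs1 : s ≤ 1)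
    (hsum : Summable fun j : ℕ =>
      absProd x j ^ (s - 1 / 2) * sizeBound s (|T^[j] x| ^ (-(1 / 2) : ℝ))) :
    ∃ S : ℂ, Tendsto (fun n : ℕ => partialF s n x 0) atTop (𝓝 S) ∧
      Tendsto (fun N : ℕ => ∑ j ∈ Finset.range N,
          phase x j * ((absProd x j ^ (s - 1 / 2) : ℝ) : ℂ) * Omega s (T^[j] x) 0)
        atTop (𝓝 S) := by
  obtain ⟨C, hC, hb⟩ := exists_norm_defect_le hs0 hs1
  set f : ℕ → ℕ → ℂ := fun n j => phase x j * ((absProd x j ^ (s - 1 / 2) : ℝ) : ℂ)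
    * defect s (sumLength x n j) (T^[j] x) with hf
  set g : ℕ → ℂ := fun j => phase x j * ((absProd x j ^ (s - 1 / 2) : ℝ) : ℂ)
    * Omega s (T^[j] x) 0 with hg
  have hlim : ∀ j, Tendsto (fun n => f n j) atTop (𝓝 (g j)) := fun j =>
    ((tendsto_defect hs0 hs1 (iterate_T_mem_Ioo hx hirr j)
      (irrational_iterate_T hirr j).ne_zero).comp (tendsto_sumLength hirr j)).const_mul _
  have hbound : ∀ n j, ‖f n j‖ ≤ C * (absProd x j ^ (s - 1 / 2)
      * sizeBound s (|T^[j] x| ^ (-(1 / 2) : ℝ))) := by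
    intro n j
    have hp : 0 ≤ absProd x j ^ (s - 1 / 2) := Real.rpow_nonneg (absProd_nonneg x j) _
    simp only [hf]
    rw [norm_mul, norm_mul, norm_phase, one_mul, Complex.norm_real, Real.norm_of_nonneg hp]
    refine (mul_le_mul_of_nonneg_left (hb _ (iterate_T_mem_Ioo hx hirr j)
      (irrational_iterate_T hirr j).ne_zero _) hp).trans (le_of_eq (by ring))
  -- For fixed j the length tends to infinity with n, so each term converges, under a majorant
  -- independent of n.
  have hT := tendsto_tsum_of_dominated_convergence (hsum.mul_left C) hlim
    (Eventually.of_forall hbound)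
  -- After n steps the leftover sum is empty and all later defects vanish, so the whole series is
  -- the partial sum.
  have hF : ∀ n, ∑' j, f n j = partialF s n x 0 := by
    intro n
    have hz : ∀ j, n ≤ j → sumLength x n j = 0 := fun j hj => by
      have := sumLength_le hx hirr n j
      omega
    rw [tsum_eq_sum (s := Finset.range n) (fun j hj => by
      rw [Finset.mem_range, not_lt] at hj
      simp only [hf]
      rw [hz j hj, defect_zero_length, mul_zero]), partialF_eq_sum_defect s x n n, hz n le_rfl]
    simp [partialF, hf]
  simp only [hF] at hT
  refine ⟨_, hT, ?_⟩
  -- The limits inherit the majorant.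
  have hgs : Summable g := Summable.of_norm_bounded (hsum.mul_left C) fun j =>
    le_of_tendsto (hlim j).norm (Eventually.of_forall fun n => hbound n j)
  exact hgs.hasSum.tendsto_sum_nat

end HardyLittlewood

/-! ### From the hypotheses to the summable majorant -/

theorem theorem2 (x : ℝ) (hx : x ∈ Set.Ioo (-1 : ℝ) 1) (hirr : Irrational x) :
    (∀ s ∈ Set.Ioo (1 / 2 : ℝ) 1,
      Summable (fun j : ℕ =>
        HardyLittlewood.absProd x j ^ (s - 1 / 2)
          / |HardyLittlewood.T^[j] x| ^ ((1 - s) / 2)) →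
      ∃ S : ℂ,
        Tendsto (fun n : ℕ => HardyLittlewood.partialF s n x 0) atTop (𝓝 S) ∧
        Tendsto (fun N : ℕ => ∑ j ∈ Finset.range N,
            HardyLittlewood.phase x j
              * ((HardyLittlewood.absProd x j ^ (s - 1 / 2) : ℝ) : ℂ)
              * HardyLittlewood.Omega s (HardyLittlewood.T^[j] x) 0)
          atTop (𝓝 S))
    ∧
    (Summable (fun j : ℕ => Real.sqrt (HardyLittlewood.absProd x j)) →
      Summable (fun j : ℕ =>
        Real.sqrt (HardyLittlewood.absProd x j)
          * Real.log (1 / |HardyLittlewood.T^[j] x|)) →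
      ∃ S : ℂ,
        Tendsto (fun n : ℕ => HardyLittlewood.partialF 1 n x 0) atTop (𝓝 S) ∧
        Tendsto (fun N : ℕ => ∑ j ∈ Finset.range N,
            HardyLittlewood.phase x j
              * ((Real.sqrt (HardyLittlewood.absProd x j) : ℝ) : ℂ)
              * HardyLittlewood.Omega 1 (HardyLittlewood.T^[j] x) 0)
          atTop (𝓝 S)) := by
  have hpos : ∀ j, 0 < |HardyLittlewood.T^[j] x| := fun j =>
    abs_pos.mpr (HardyLittlewood.irrational_iterate_T hirr j).ne_zero
  have hle : ∀ j, |HardyLittlewood.T^[j] x| ≤ 1 := fun j =>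
    (abs_lt.mpr (HardyLittlewood.iterate_T_mem_Ioo hx hirr j)).le
  have hY : ∀ j, 1 ≤ |HardyLittlewood.T^[j] x| ^ (-(1 / 2) : ℝ) := fun j =>
    Real.one_le_rpow_of_pos_of_le_one_of_nonpos (hpos j) (hle j) (by norm_num)
  constructor
  · rintro s ⟨hs, hs1⟩ hsum
    refine HardyLittlewood.exists_tendsto_of_summable_sizeBound hx hirr (by linarith) hs1.le ?_
    -- For s < 1, `sizeBound s Y` is at most Y^{1-s}/(1-s), and Y = |T^j x|^{-1/2} gives the
    -- exponent (1-s)/2 of the hypothesis.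
    refine Summable.of_nonneg_of_le (fun j => ?_) (fun j => ?_) (hsum.mul_left (1 / (1 - s)))
    · exact mul_nonneg (Real.rpow_nonneg (HardyLittlewood.absProd_nonneg x j) _)
        (zero_le_one.trans (HardyLittlewood.one_le_sizeBound (hY j)))
    · have hp : 0 ≤ HardyLittlewood.absProd x j ^ (s - 1 / 2) :=
        Real.rpow_nonneg (HardyLittlewood.absProd_nonneg x j) _
      have h1s : 0 < 1 - s := by linarith
      have e : (|HardyLittlewood.T^[j] x| ^ (-(1 / 2) : ℝ)) ^ (1 - s)
          = (|HardyLittlewood.T^[j] x| ^ ((1 - s) / 2))⁻¹ := by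
        rw [← Real.rpow_mul (hpos j).le, ← Real.rpow_neg (hpos j).le]
        congr 1; ring
      rw [HardyLittlewood.sizeBound_of_lt_one hs1, e]
      have h2 : 1 + ((|HardyLittlewood.T^[j] x| ^ ((1 - s) / 2))⁻¹ - 1) / (1 - s)
          ≤ 1 / (1 - s) * (|HardyLittlewood.T^[j] x| ^ ((1 - s) / 2))⁻¹ := by
        have h3 : 1 ≤ 1 / (1 - s) := by rw [le_div_iff₀ h1s]; linarith
        have h4 : ((|HardyLittlewood.T^[j] x| ^ ((1 - s) / 2))⁻¹ - 1) / (1 - s)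
            = 1 / (1 - s) * (|HardyLittlewood.T^[j] x| ^ ((1 - s) / 2))⁻¹ - 1 / (1 - s) := by ring
        linarith
      refine (mul_le_mul_of_nonneg_left h2 hp).trans (le_of_eq ?_)
      rw [div_eq_mul_inv (HardyLittlewood.absProd x j ^ (s - 1 / 2))]
      ring
  · intro h1 h2
    have hsq : ∀ j, Real.sqrt (HardyLittlewood.absProd x j)
        = HardyLittlewood.absProd x j ^ (1 - 1 / 2 : ℝ) := by
      intro j; rw [Real.sqrt_eq_rpow]; norm_num
    -- For s = 1 the majorant factor is 1 + log Y = 1 + ½ log(1/|T^j x|), which is why two series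
    -- are assumed to converge.
    have hsum : Summable fun j : ℕ => HardyLittlewood.absProd x j ^ (1 - 1 / 2 : ℝ)
        * HardyLittlewood.sizeBound 1 (|HardyLittlewood.T^[j] x| ^ (-(1 / 2) : ℝ)) := by
      refine (h1.add (h2.mul_left (1 / 2))).congr fun j => ?_
      rw [HardyLittlewood.sizeBound_one (hY j), ← hsq, Real.log_rpow (hpos j), one_div |_|,
        Real.log_inv]
      ring
    have := HardyLittlewood.exists_tendsto_of_summable_sizeBound hx hirr one_pos le_rfl hsum
    simpa only [hsq] using this
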